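/- Let $p$ be a probability distribution on $\{0,1,2,\dots\}$ with mean $m=\sum_k k\,p(k)$, and suppose that $1/0.36<m<\infty$. Let $\mathcal G$ be the Galton–Watson tree with offspring distribution $p$ and root $\rho$, that is, the random rooted tree in which the numbers of children of the vertices are i.i.d. with law $p$. Given $\mathcal G$, let $\mathbf X=\{X_t,\,t\ge 0\}$ be the vertex-reinforced jump process on $\mathcal G$ started at $X_0=\rho$: the right-continuous process on the vertices of $\mathcal G$ that jumps only between nearest neighbours and that, given $(X_s)_{0\le s\le t}$ and $X_t=x$, jumps to a neighbour $y$ of $x$ at rate $$L(y,t)=1+\int_0^t \mathbf 1_{\{X_s=y\}}\,ds .$$ (If the root has no children, the process stays there forever.) Then $\mathbf X$ is transient, that is, under the joint law of $\mathcal G$ and $\mathbf X$, with positive probability $\mathbf X$ leaves $\rho$ and never returns to $\rho$: $$\mathbf P\bigl(\exists\,\sigma>0:\ X_t=\rho \text{ for all } t<\sigma \text{ and } X_t\ne\rho \text{ for all } t\ge\sigma\bigr)>0 .$$ -/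

import Mathlib

open MeasureTheory ProbabilityTheory Finset
open scoped ENNReal NNReal

noncomputable section

namespace VRJP

/-- Vertices of trees, in Ulam–Harris notation: `[]` is the root, the children of `v` are
`i :: v`, and the parent of `i :: v` is `v`. -/
abbrev Vertex : Type := List ℕ

instance : MeasurableSpace Vertex := ⊤

instance : DiscreteMeasurableSpace Vertex := ⟨fun _ => trivial⟩

/-- The root. -/
abbrev root : Vertex := []

/-- A rooted, locally finite tree, encoded by the number of children of every vertex:
the children of `v` in the tree are `i :: v` with `i < N v`. The tree itself is the set of words
that are reached from the root in this way. -/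
abbrev Offspring : Type := Vertex → ℕ

/-- The parent of a vertex, as a set with at most one element (none for the root). -/
def parents : Vertex → Finset Vertex
  | [] => ∅
  | _ :: v => {v}

/-- The nearest neighbours of a vertex `v` in the tree given by `N`:
its children and, unless `v` is the root, its parent. -/
def nbrs (N : Offspring) (v : Vertex) : Finset Vertex :=
  (Finset.range (N v)).image (fun i => i :: v) ∪ parents v

/-- Mean of the offspring distribution `p`. -/
def offspringMean (p : PMF ℕ) : ℝ≥0∞ := ∑' k : ℕ, p k * (k : ℝ≥0∞)

/-- The law of the Galton–Watson tree: the numbers of children are i.i.d. with law `p`. -/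
def gwLaw (p : PMF ℕ) : Measure Offspring :=
  Measure.infinitePi (fun _ : Vertex => p.toMeasure)

instance (p : PMF ℕ) : IsProbabilityMeasure (gwLaw p) := by
  unfold gwLaw; infer_instance

/-- Jump data of a pure jump process started from a vertex `(ω 0).2` at time `0`: the component
`(ω (n + 1)).1` is the length of the `(n+1)`-st sojourn, which is spent at the vertex `(ω n).2`,
and `(ω (n + 1)).2` is the vertex to which the process jumps at the end of it. -/
abbrev JumpData : Type := ℕ → ℝ≥0 × Vertex

/-- The time of the `n`-th jump. -/
def jumpTime (ω : JumpData) (n : ℕ) : ℝ≥0 := ∑ k ∈ Finset.range n, (ω (k + 1)).1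

/-- `L(y, t)` at the time `t` of the `n`-th jump: one plus the time spent at `y` so far.
As long as the process then stays at the vertex that it has just entered, the value for every
other vertex, in particular for every neighbour of that vertex, does not change. -/
def localTime (ω : JumpData) (n : ℕ) (y : Vertex) : ℝ≥0 :=
  1 + ∑ k ∈ Finset.range n, if (ω k).2 = y then (ω (k + 1)).1 else 0

/-- The exponential distribution with parameter `r`, on `[0, ∞)`. -/
def holdLaw (r : ℝ≥0) : Measure ℝ≥0 := (expMeasure (r : ℝ)).map Real.toNNReal

/-- The total rate of jumps towards the vertices of `F` from the time of the `n`-th jump on. -/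
def totalRate (F : Finset Vertex) (ω : JumpData) (n : ℕ) : ℝ≥0 := ∑ v ∈ F, localTime ω n v

/-- The law of the next sojourn time and of the next vertex, given the process up to the time of
the `n`-th jump, if `F` is the set of neighbours of the vertex entered at that time, and each
`v` in `F` is jumped to at rate `localTime ω n v`: an exponential time whose parameter is the sum
of the rates and, independently, a neighbour chosen with probability proportional to its rate.
If there are no neighbours, the process stays where it is (for one unit of time, after which the
same rule applies again, hence forever). -/
def stepLaw (F : Finset Vertex) (ω : JumpData) (n : ℕ) : Measure (ℝ≥0 × Vertex) :=
  if F = ∅ then Measure.dirac (1, (ω n).2)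
  else ∑ v ∈ F, ((localTime ω n v / totalRate F ω n : ℝ≥0) : ℝ≥0∞) •
    (holdLaw (totalRate F ω n)).map (fun s => (s, v))

lemma localTime_pos (ω : JumpData) (n : ℕ) (v : Vertex) : 0 < localTime ω n v := by
  unfold localTime; positivity

lemma totalRate_pos {F : Finset Vertex} (hF : F ≠ ∅) (ω : JumpData) (n : ℕ) :
    0 < totalRate F ω n :=
  Finset.sum_pos (fun v _ => localTime_pos ω n v) (Finset.nonempty_iff_ne_empty.2 hF)

lemma isProbabilityMeasure_holdLaw {r : ℝ≥0} (hr : 0 < r) :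
    IsProbabilityMeasure (holdLaw r) := by
  have : IsProbabilityMeasure (expMeasure (r : ℝ)) :=
    isProbabilityMeasure_expMeasure (by exact_mod_cast hr)
  exact Measure.isProbabilityMeasure_map measurable_real_toNNReal.aemeasurable

instance isProbabilityMeasure_stepLaw (F : Finset Vertex) (ω : JumpData) (n : ℕ) :
    IsProbabilityMeasure (stepLaw F ω n) := by
  unfold stepLaw
  split_ifs with hF
  · infer_instance
  · have hR := totalRate_pos hF ω n
    have := isProbabilityMeasure_holdLaw hR
    constructor
    rw [Measure.finsetSum_apply]
    have h1 : ∀ v : Vertex,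
        ((holdLaw (totalRate F ω n)).map (fun s => (s, v))) Set.univ = 1 := fun v => by
      have : IsProbabilityMeasure ((holdLaw (totalRate F ω n)).map (fun s => (s, v))) :=
        Measure.isProbabilityMeasure_map (by fun_prop)
      exact measure_univ
    simp only [Measure.smul_apply, h1, smul_eq_mul, mul_one]
    rw [← ENNReal.ofNNReal_finsetSum, ← Finset.sum_div]
    change (((totalRate F ω n) / (totalRate F ω n) : ℝ≥0) : ℝ≥0∞) = 1
    rw [div_self hR.ne', ENNReal.coe_one]

lemma measurable_localTime (n : ℕ) (v : Vertex) :
    Measurable (fun ω : JumpData => localTime ω n v) := by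
  unfold localTime
  refine measurable_const.add (Finset.measurable_sum _ fun k _ => ?_)
  refine Measurable.ite ?_ (by fun_prop) measurable_const
  exact measurableSet_eq_fun (by fun_prop) measurable_const

lemma measurable_totalRate (F : Finset Vertex) (n : ℕ) :
    Measurable (fun ω : JumpData => totalRate F ω n) :=
  Finset.measurable_sum _ fun v _ => measurable_localTime n v

lemma measurable_holdLaw : Measurable holdLaw := by
  refine Measure.measurable_of_measurable_coe _ fun s hs => ?_
  have hs' := measurable_real_toNNReal hs
  have : (fun r : ℝ≥0 => holdLaw r s) =
      fun r : ℝ≥0 => ∫⁻ x in Real.toNNReal ⁻¹' s, exponentialPDF (r : ℝ) x := by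
    funext r
    rw [holdLaw, Measure.map_apply measurable_real_toNNReal hs, expMeasure, gammaMeasure,
      withDensity_apply _ hs']
    rfl
  rw [this]
  refine Measurable.lintegral_prod_right' (f := fun q : ℝ≥0 × ℝ => exponentialPDF (q.1 : ℝ) q.2) ?_
  simp only [exponentialPDF_eq]
  refine ENNReal.measurable_ofReal.comp (Measurable.ite ?_ (by fun_prop) measurable_const)
  exact measurableSet_le measurable_const measurable_snd

lemma measurable_stepLaw (F : Finset Vertex) (n : ℕ) :
    Measurable (fun ω : JumpData => stepLaw F ω n) := by
  unfold stepLaw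
  split_ifs with hF
  · exact Measure.measurable_dirac.comp (by fun_prop)
  · refine Measure.measurable_of_measurable_coe _ fun s hs => ?_
    simp only [Measure.finsetSum_apply, Measure.smul_apply, smul_eq_mul]
    refine Finset.measurable_sum _ fun v _ => ?_
    refine Measurable.mul ?_ ?_
    · exact ((measurable_localTime n v).div (measurable_totalRate F n)).coe_nnreal_ennreal
    · have h := (Measure.measurable_map (fun s : ℝ≥0 => (s, v)) (by fun_prop)).comp
        (measurable_holdLaw.comp (measurable_totalRate F n))
      exact (Measure.measurable_coe hs).comp h

/-- The jump data up to step `n`, continued arbitrarily. -/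
def extend (n : ℕ) (h : (i : Finset.Iic n) → ℝ≥0 × Vertex) : JumpData :=
  fun k => h ⟨min k n, Finset.mem_Iic.2 (min_le_right k n)⟩

lemma measurable_extend (n : ℕ) : Measurable (extend n) :=
  measurable_pi_lambda _ fun _ => measurable_pi_apply _

lemma measurable_step_joint (n : ℕ) :
    Measurable (fun q : Offspring × ((i : Finset.Iic n) → ℝ≥0 × Vertex) =>
      stepLaw (nbrs q.1 (extend n q.2 n).2) (extend n q.2) n) := by
  let _ : MeasurableSpace (Finset Vertex) := ⊤
  have : DiscreteMeasurableSpace (Finset Vertex) := ⟨fun _ => trivial⟩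
  have h1 : Measurable (fun q : Finset Vertex × ((i : Finset.Iic n) → ℝ≥0 × Vertex) =>
      stepLaw q.1 (extend n q.2) n) :=
    measurable_from_prod_countable_right fun F => (measurable_stepLaw F n).comp (measurable_extend n)
  have h3 : Measurable (fun q : Offspring × Vertex => nbrs q.1 q.2) := by
    refine measurable_from_prod_countable_left fun y => ?_
    unfold nbrs
    exact (measurable_of_countable (fun k : ℕ =>
      (Finset.range k).image (fun i => i :: y) ∪ parents y)).comp (measurable_pi_apply y)
  have h4 : Measurable (fun q : Offspring × ((i : Finset.Iic n) → ℝ≥0 × Vertex) =>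
      (extend n q.2 n).2) :=
    measurable_snd.comp ((measurable_pi_apply n).comp ((measurable_extend n).comp measurable_snd))
  exact h1.comp ((h3.comp (measurable_fst.prodMk h4)).prodMk measurable_snd)

/-- The transition kernel of the vertex-reinforced jump process on the tree given by `N`,
from the jump data up to the `n`-th jump to the next sojourn time and the next vertex. -/
def stepKernel (N : Offspring) (n : ℕ) :
    Kernel ((i : Finset.Iic n) → ℝ≥0 × Vertex) (ℝ≥0 × Vertex) where
  toFun h := stepLaw (nbrs N (extend n h n).2) (extend n h) n
  measurable' := (measurable_step_joint n).comp measurable_prodMk_left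

instance (N : Offspring) (n : ℕ) : IsMarkovKernel (stepKernel N n) :=
  ⟨fun _ => isProbabilityMeasure_stepLaw _ _ _⟩

/-- The law of the jump data of the vertex-reinforced jump process started from the root, on the
fixed tree given by `N`. -/
def vrjpLaw (N : Offspring) : Measure JumpData :=
  Kernel.traj (X := fun _ : ℕ => ℝ≥0 × Vertex) (stepKernel N) 0 (fun _ => (0, root))

instance (N : Offspring) : IsProbabilityMeasure (vrjpLaw N) := by
  unfold vrjpLaw; infer_instance

lemma measurable_partialTraj (n : ℕ) :
    Measurable (fun N : Offspring =>
      Kernel.partialTraj (X := fun _ : ℕ => ℝ≥0 × Vertex) (stepKernel N) 0 n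
        (fun _ => (0, root))) := by
  induction n with
  | zero => simp only [Kernel.partialTraj_self]; exact measurable_const
  | succ n ih =>
    let J : Kernel (Offspring × ((i : Finset.Iic n) → ℝ≥0 × Vertex)) (ℝ≥0 × Vertex) :=
      ⟨_, measurable_step_joint n⟩
    have : IsMarkovKernel J := ⟨fun _ => isProbabilityMeasure_stepLaw _ _ _⟩
    let K : Kernel Offspring ((i : Finset.Iic n) → ℝ≥0 × Vertex) := ⟨_, ih⟩
    have : IsMarkovKernel K := ⟨fun N => by
      change IsProbabilityMeasure (Kernel.partialTraj (X := fun _ : ℕ => ℝ≥0 × Vertex)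
        (stepKernel N) 0 n (fun _ => (0, root)))
      infer_instance⟩
    refine Measure.measurable_of_measurable_coe _ fun s hs => ?_
    simp only [Kernel.partialTraj_succ_eq_comp (Nat.zero_le n)]
    simp only [Kernel.comp_apply' _ _ _ hs]
    refine Measurable.lintegral_kernel_prod_right (κ := K)
      (f := fun N h => Kernel.partialTraj (X := fun _ : ℕ => ℝ≥0 × Vertex)
        (stepKernel N) n (n + 1) h s) ?_
    have e : Function.uncurry (fun (N : Offspring) (h : (i : Finset.Iic n) → ℝ≥0 × Vertex) =>
        Kernel.partialTraj (X := fun _ : ℕ => ℝ≥0 × Vertex) (stepKernel N) n (n + 1) h s) =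
        fun q => J q (Prod.mk q ⁻¹' {r | IicProdIoc (X := fun _ : ℕ => ℝ≥0 × Vertex) n (n + 1)
          (r.1.2, MeasurableEquiv.piSingleton (X := fun _ : ℕ => ℝ≥0 × Vertex) n r.2) ∈ s}) := by
      funext ⟨N, h⟩
      simp only [Function.uncurry_apply_pair]
      have hI : Measurable (IicProdIoc (X := fun _ : ℕ => ℝ≥0 × Vertex) n (n + 1)) :=
        measurable_IicProdIoc
      rw [Kernel.partialTraj_succ_self, Kernel.map_apply' _ hI _ hs,
        Kernel.prod_apply, Kernel.id_apply, Measure.dirac_prod,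
        Measure.map_apply measurable_prodMk_left (hI hs),
        Kernel.map_apply' _ (by fun_prop) _ (measurable_prodMk_left (hI hs))]
      rfl
    rw [e]
    refine Kernel.measurable_kernel_prodMk_left ?_
    exact measurableSet_preimage ((measurable_IicProdIoc
      (X := fun _ : ℕ => ℝ≥0 × Vertex) (m := n) (n := n + 1)).comp (by fun_prop)) hs

lemma measurable_vrjpLaw : Measurable vrjpLaw := by
  refine Measurable.measure_of_isPiSystem_of_isProbabilityMeasure
    (S := measurableCylinders (fun _ : ℕ => ℝ≥0 × Vertex))
    generateFrom_measurableCylinders.symm isPiSystem_measurableCylinders fun t ht => ?_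
  rw [measurableCylinders_nat] at ht
  simp only [Set.mem_iUnion, Set.mem_singleton_iff] at ht
  obtain ⟨n, S, hS, rfl⟩ := ht
  have : (fun N => vrjpLaw N (cylinder (Finset.Iic n) S)) = fun N =>
      Kernel.partialTraj (X := fun _ : ℕ => ℝ≥0 × Vertex) (stepKernel N) 0 n
        (fun _ => (0, root)) S := by
    funext N
    rw [← Kernel.traj_map_frestrictLe_apply, Measure.map_apply (by fun_prop) hS]
    rfl
  rw [this]
  exact (Measure.measurable_coe hS).comp (measurable_partialTraj n)

/-- The law of the vertex-reinforced jump process as a kernel from the space of trees. -/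
def vrjpKernel : Kernel Offspring JumpData := ⟨vrjpLaw, measurable_vrjpLaw⟩

instance : IsMarkovKernel vrjpKernel :=
  ⟨fun N => inferInstanceAs (IsProbabilityMeasure (vrjpLaw N))⟩

/-- The joint law of the Galton–Watson tree with offspring distribution `p` and of the
vertex-reinforced jump process on it: given the tree, the process has law `vrjpLaw`. -/
def vrjpGW (p : PMF ℕ) : Measure (Offspring × JumpData) := gwLaw p ⊗ₘ vrjpKernel

instance (p : PMF ℕ) : IsProbabilityMeasure (vrjpGW p) := by
  unfold vrjpGW; infer_instance

open Classical in
/-- The position at time `t` of the process with jump data `ω`: the vertex occupied between the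
`n`-th and the `(n+1)`-st jump, if `t` lies between these (`n` is the first index whose sojourn
ends after `t`), and `none` if `t` is not smaller than the limit of the jump times. -/
def process (ω : JumpData) (t : ℝ≥0) : Option Vertex :=
  if h : ∃ n, t < jumpTime ω (n + 1) then some (ω (Nat.find h)).2 else none

/-- The trajectory `x`, started at `ρ`, leaves `ρ` and does not return to it: there is a time
`σ > 0` before which it is at `ρ` and from which on it is never at `ρ`. -/
def NeverReturns (x : ℝ≥0 → Option Vertex) (ρ : Vertex) : Prop :=
  ∃ σ : ℝ≥0, 0 < σ ∧ (∀ t < σ, x t = some ρ) ∧ ∀ t, σ ≤ t → x t ≠ some ρ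

end VRJP

end

/-!
The event that the process never returns to the root is already decided by the first excursion from
the root, and it is bounded from below by a Lyapunov function of the state of the process.

Suppose that a vertex `v` is entered from its parent when the local time of the parent is `r`. Until
the process returns to the parent, this local time stays frozen, so that the parent acts as a trap
which is entered at rate `r` from `v`. The local time spent at `v` before that is exponential with
parameter `r`, and during it an unvisited child `w` is visited for the first time at rate `1`. If
that happens when the local time of `v` is `1 + t`, then the same situation recurs at `w`, with
frozen local time `1 + t`. Keeping only the first visits to the children gives a multitype branching
process with mean operator `g ↦ m ∫ exp (-(2 + s) t) g t dt`, the type being the local time of the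
parent minus one. For `g s = exp (-s / 2)` this is `m exp (s / 2) / (5 / 2 + s) * g s`, which is at
least `g s` once `m ≥ 5 / 2`; since `1 / 0.36 > 5 / 2`, there is room to truncate the offspring at a
level `K` and to absorb the nonlinear terms.

The function `escape r x` is a lower bound for the probability of never returning from `v` to its
parent, where `x = ε u exp (-a / 2)` when `1 + a` is the present local time of `v` and `u` is the
number of its unvisited children (among the first `K`). The process is back at the root only if it
returns to the parent from each vertex between the present position and the root, and
`potential` is the corresponding product of the numbers `1 - escape`.
The inequality `escape_drift_le` says that this product is a supermartingale. Its terms linear in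
`ε` cancel exactly, and the quadratic term in `escape` pays for the quadratic error.

The number of children of a vertex is revealed only when the vertex is visited for the first time:
`lintegral_returnProb_le` averages the conditional probability of a return within `j` jumps over the
unexplored part of the tree, and proves by induction on `j` that it is at most `potential`. At a
first visit, `lintegral_offspring_escape_le` restores the constant `ε`. The bound does not depend on
`j`, hence it passes to the limit.
-/

noncomputable section

namespace VRJP

/-! ### Exponential sojourn times -/

lemma integral_exp_neg_holdLaw {ρ : ℝ≥0} (hρ : 0 < ρ) {b : ℝ} (hb : 0 ≤ b) :
    ∫ τ : ℝ≥0, Real.exp (-(b * τ)) ∂holdLaw ρ = ρ / (ρ + b) := by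
  have hρ' : (0 : ℝ) < ρ := by exact_mod_cast hρ
  have h1 : ∀ x : ℝ, (exponentialPDF (ρ : ℝ) x).toReal • Real.exp (-(b * (x.toNNReal : ℝ))) =
      (Set.Ici (0 : ℝ)).indicator (fun x => ρ * Real.exp (-(ρ + b) * x)) x := by
    intro x
    by_cases hx : 0 ≤ x
    · rw [Set.indicator_of_mem (Set.mem_Ici.2 hx), exponentialPDF_of_nonneg hx,
        ENNReal.toReal_ofReal (by positivity), Real.coe_toNNReal x hx, smul_eq_mul, mul_assoc,
        ← Real.exp_add]
      ring_nf
    · rw [Set.indicator_of_notMem (by simpa using hx), exponentialPDF_of_neg (not_le.1 hx)]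
      simp
  have hpdf : Measurable (exponentialPDF (ρ : ℝ)) :=
    (measurable_exponentialPDFReal _).ennreal_ofReal
  rw [holdLaw, integral_map measurable_real_toNNReal.aemeasurable
    (by fun_prop), expMeasure, gammaMeasure]
  change ∫ x, _ ∂(volume.withDensity (exponentialPDF (ρ : ℝ))) = _
  rw [integral_withDensity_eq_integral_toReal_smul hpdf
    (ae_of_all _ fun x => by simp [exponentialPDF])]
  simp_rw [h1]
  rw [integral_indicator measurableSet_Ici, integral_Ici_eq_integral_Ioi, integral_const_mul,
    integral_exp_mul_Ioi (by linarith)]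
  rw [mul_zero, Real.exp_zero, neg_div_neg_eq, mul_one_div]

lemma holdLaw_singleton_zero (ρ : ℝ≥0) : holdLaw ρ {0} = 0 := by
  rw [holdLaw, Measure.map_apply measurable_real_toNNReal (measurableSet_singleton _)]
  have : Real.toNNReal ⁻¹' {0} = Set.Iic 0 := by ext; simp
  rw [this, expMeasure, gammaMeasure]
  change (volume.withDensity (exponentialPDF (ρ : ℝ))) _ = 0
  rw [withDensity_apply _ measurableSet_Iic, setLIntegral_congr Iio_ae_eq_Iic.symm]
  exact lintegral_exponentialPDF_of_nonpos le_rfl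

lemma lintegral_holdLaw {ρ : ℝ≥0} (hρ : 0 < ρ) (A B : ℝ)
    (h : ∀ τ : ℝ≥0, 0 ≤ 1 - A * Real.exp (-(1 / 2 * τ)) + B * Real.exp (-(1 * τ))) :
    ∫⁻ τ : ℝ≥0, ENNReal.ofReal
        (1 - A * Real.exp (-(1 / 2 * τ)) + B * Real.exp (-(1 * τ))) ∂holdLaw ρ =
      ENNReal.ofReal (1 - A * (ρ / (ρ + 1 / 2)) + B * (ρ / (ρ + 1))) := by
  have := isProbabilityMeasure_holdLaw hρ
  have hint : ∀ b : ℝ, 0 ≤ b → Integrable (fun τ : ℝ≥0 => Real.exp (-(b * τ))) (holdLaw ρ) := by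
    intro b hb
    refine Integrable.of_bound (C := 1) (by fun_prop) (ae_of_all _ fun τ => ?_)
    rw [Real.norm_of_nonneg (Real.exp_pos _).le, Real.exp_le_one_iff]
    have : 0 ≤ b * τ := by positivity
    linarith
  have h1 := (hint (1 / 2) (by norm_num)).const_mul A
  have h2 := (hint 1 (by norm_num)).const_mul B
  have h3 : Integrable (fun τ : ℝ≥0 => 1 - A * Real.exp (-(1 / 2 * (τ : ℝ)))) (holdLaw ρ) :=
    (integrable_const 1).sub h1
  rw [← ofReal_integral_eq_lintegral_ofReal (f := fun τ : ℝ≥0 => 1 -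
      A * Real.exp (-(1 / 2 * (τ : ℝ))) + B * Real.exp (-(1 * (τ : ℝ)))) (h3.add h2)
      (ae_of_all _ h), integral_add h3 h2, integral_sub (integrable_const 1) h1, integral_const_mul,
    integral_const_mul, integral_exp_neg_holdLaw hρ (by norm_num),
    integral_exp_neg_holdLaw hρ (by norm_num)]
  simp

/-! ### Revealing the tree vertex by vertex -/

lemma measurable_update_offspring (y : Vertex) :
    Measurable (fun q : ℕ × Offspring => Function.update q.2 y q.1) := by
  refine measurable_pi_lambda _ fun v => ?_
  by_cases hv : v = y
  · subst hv; simpa using measurable_fst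
  · simp only [Function.update_of_ne hv]
    fun_prop

/-- Resampling the number of children of one vertex leaves the law of the tree invariant. -/
lemma map_update_gwLaw (p : PMF ℕ) (y : Vertex) :
    (p.toMeasure.prod (gwLaw p)).map (fun q => Function.update q.2 y q.1) = gwLaw p := by
  have hm := measurable_update_offspring y
  refine Measure.eq_infinitePi _ fun s t ht => ?_
  rw [Measure.map_apply hm (MeasurableSet.pi s.countable_toSet fun i _ => ht i)]
  by_cases hy : y ∈ s
  · have : (fun q : ℕ × Offspring => Function.update q.2 y q.1) ⁻¹' (Set.pi s t) =
        t y ×ˢ Set.pi ((s.erase y : Finset Vertex) : Set Vertex) t := by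
      ext q
      simp only [Set.mem_preimage, Set.mem_pi, Set.mem_prod, Finset.mem_coe, Finset.mem_erase]
      constructor
      · intro h
        refine ⟨by simpa using h y hy, fun v hv => ?_⟩
        simpa [Function.update_of_ne hv.1] using h v hv.2
      · rintro ⟨h1, h2⟩ v hv
        by_cases hvy : v = y
        · subst hvy; simpa using h1
        · simpa [Function.update_of_ne hvy] using h2 v ⟨hvy, hv⟩
    rw [this, Measure.prod_prod, gwLaw, Measure.infinitePi_pi _ (fun i _ => ht i),
      Finset.mul_prod_erase s (fun i => p.toMeasure (t i)) hy]
  · have : (fun q : ℕ × Offspring => Function.update q.2 y q.1) ⁻¹' (Set.pi s t) =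
        Set.univ ×ˢ Set.pi (s : Set Vertex) t := by
      ext q
      simp only [Set.mem_preimage, Set.mem_pi, Set.mem_prod, Finset.mem_coe, Set.mem_univ,
        true_and]
      refine forall₂_congr fun v hv => ?_
      rw [Function.update_of_ne (by rintro rfl; exact hy hv)]
    rw [this, Measure.prod_prod, gwLaw, Measure.infinitePi_pi _ (fun i _ => ht i), measure_univ,
      one_mul]

lemma measurable_piecewise_offspring (A : Finset Vertex) (N : Offspring) :
    Measurable fun N' : Offspring => A.piecewise N N' :=
  measurable_pi_lambda _ fun v => by
    by_cases hv : v ∈ A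
    · simp [Finset.piecewise_eq_of_mem _ _ _ hv]
    · simpa [Finset.piecewise_eq_of_notMem _ _ _ hv] using measurable_pi_apply v

/-- On the event that `y` is outside the explored set `A`, the number of children of `y` can be
drawn first, so that `y` becomes explored. -/
lemma lintegral_gwLaw_piecewise (p : PMF ℕ) {A : Finset Vertex} {y : Vertex} (hy : y ∉ A)
    (N : Offspring) {f : Offspring → ℝ≥0∞} (hf : Measurable f) :
    ∫⁻ N', f (A.piecewise N N') ∂gwLaw p =
      ∫⁻ k, ∫⁻ N', f ((insert y A).piecewise (Function.update N y k) N') ∂gwLaw p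
        ∂p.toMeasure := by
  have hg : Measurable fun N' : Offspring => f (A.piecewise N N') :=
    hf.comp (measurable_piecewise_offspring A N)
  have hm := measurable_update_offspring y
  have key : ∀ (k : ℕ) (N' : Offspring), A.piecewise N (Function.update N' y k) =
      (insert y A).piecewise (Function.update N y k) N' := by
    intro k N'
    funext v
    by_cases hv : v = y
    · subst hv; simp [hy]
    · by_cases hA : v ∈ A <;> simp [hv, hA]
  conv_lhs => rw [← map_update_gwLaw p y]
  have hg' : Measurable fun q : ℕ × Offspring =>
    f (A.piecewise N (Function.update q.2 y q.1)) := hg.comp hm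
  rw [lintegral_map hg hm, lintegral_prod _ hg'.aemeasurable]
  simp_rw [key]

/-! ### Jump data, local times and visited vertices -/

/-- The jump data `ω` up to step `m`, continued by `z` at all later steps. Only the entry at
`m + 1` matters; the constant continuation agrees with the convention of `extend`. -/
def snoc (m : ℕ) (ω : JumpData) (z : ℝ≥0 × Vertex) : JumpData :=
  fun k => if k ≤ m then ω k else z

lemma snoc_of_le {m k : ℕ} (h : k ≤ m) (ω : JumpData) (z : ℝ≥0 × Vertex) :
    snoc m ω z k = ω k := if_pos h

@[simp] lemma snoc_succ (m : ℕ) (ω : JumpData) (z : ℝ≥0 × Vertex) :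
    snoc m ω z (m + 1) = z := if_neg (by omega)

lemma measurable_snoc (m : ℕ) :
    Measurable fun q : JumpData × (ℝ≥0 × Vertex) => snoc m q.1 q.2 := by
  refine measurable_pi_lambda _ fun k => ?_
  unfold snoc
  split_ifs <;> fun_prop

/-- The vertices visited before the `(m+1)`-st jump, the one entered at the `m`-th jump included. -/
def visited (m : ℕ) (ω : JumpData) : Finset Vertex :=
  (Finset.range (m + 1)).image fun k => (ω k).2

lemma mem_visited {m : ℕ} {ω : JumpData} {y : Vertex} :
    y ∈ visited m ω ↔ ∃ k ≤ m, (ω k).2 = y := by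
  simp [visited]

lemma visited_snoc (m : ℕ) (ω : JumpData) (z : ℝ≥0 × Vertex) :
    visited (m + 1) (snoc m ω z) = insert z.2 (visited m ω) := by
  ext y
  rw [Finset.mem_insert, mem_visited, mem_visited]
  constructor
  · rintro ⟨k, hk, rfl⟩
    rcases Nat.lt_or_ge m k with h | h
    · obtain rfl : k = m + 1 := by omega
      simp
    · exact Or.inr ⟨k, h, by rw [snoc_of_le h]⟩
  · rintro (rfl | ⟨k, hk, rfl⟩)
    · exact ⟨m + 1, le_rfl, by simp⟩
    · exact ⟨k, by omega, by rw [snoc_of_le hk]⟩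

lemma one_le_localTime (ω : JumpData) (m : ℕ) (y : Vertex) : 1 ≤ localTime ω m y :=
  le_self_add

lemma localTime_snoc (m : ℕ) (ω : JumpData) (z : ℝ≥0 × Vertex) (y : Vertex) :
    localTime (snoc m ω z) (m + 1) y = localTime ω m y + if (ω m).2 = y then z.1 else 0 := by
  unfold localTime
  rw [Finset.sum_range_succ, snoc_succ, snoc_of_le le_rfl, add_assoc]
  congr 2
  refine Finset.sum_congr rfl fun k hk => ?_
  have hk := Finset.mem_range.1 hk
  rw [snoc_of_le hk.le, snoc_of_le (by omega)]

lemma localTime_eq_one {m : ℕ} {ω : JumpData} {y : Vertex} (hy : y ∉ visited m ω) :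
    localTime ω m y = 1 := by
  unfold localTime
  rw [add_eq_left]
  refine Finset.sum_eq_zero fun k hk => if_neg fun h => hy ?_
  exact mem_visited.2 ⟨k, (Finset.mem_range.1 hk).le, h⟩

/-! ### Return probabilities -/

/-- The process stays at the root for a positive time, and is away from the root from its first to
its `n`-th jump. -/
def noReturn (n : ℕ) : Set JumpData :=
  {ω | (ω 0).2 = root ∧ 0 < (ω 1).1 ∧ ∀ k < n, (ω (k + 1)).2 ≠ root}

lemma measurableSet_noReturn (n : ℕ) : MeasurableSet (noReturn n) := by
  refine MeasurableSet.inter ?_ (MeasurableSet.inter ?_ ?_)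
  · exact measurableSet_eq_fun (by fun_prop) measurable_const
  · exact measurableSet_lt measurable_const (by fun_prop)
  · have : {ω : JumpData | ∀ k < n, (ω (k + 1)).2 ≠ root} =
        ⋂ k, ⋂ (_ : k < n), {ω : JumpData | (ω (k + 1)).2 = root}ᶜ := by
      ext; simp
    change MeasurableSet {ω : JumpData | ∀ k < n, (ω (k + 1)).2 ≠ root}
    rw [this]
    exact MeasurableSet.iInter fun k => MeasurableSet.iInter fun _ =>
      (measurableSet_eq_fun (by fun_prop) measurable_const).compl

/-- The probability that `noReturn` fails by the `(m+j)`-th jump for the process on the tree `N`,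
given its jump data `ω` up to the `m`-th jump. -/
def returnProb (N : Offspring) : ℕ → ℕ → JumpData → ℝ≥0∞
  | 0, m, ω => (noReturn m)ᶜ.indicator 1 ω
  | j + 1, m, ω => ∫⁻ z, returnProb N j (m + 1) (snoc m ω z) ∂stepLaw (nbrs N (ω m).2) ω m

lemma returnProb_le_one (N : Offspring) (j m : ℕ) (ω : JumpData) : returnProb N j m ω ≤ 1 := by
  induction j generalizing m ω with
  | zero => exact Set.indicator_le_self' (fun _ _ => zero_le) _
  | succ j ih =>
    calc returnProb N (j + 1) m ω ≤ ∫⁻ _, 1 ∂stepLaw (nbrs N (ω m).2) ω m :=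
          lintegral_mono fun z => ih _ _
      _ = 1 := by simp

lemma measurable_stepLaw_nbrs (m : ℕ) :
    Measurable fun q : Offspring × JumpData => stepLaw (nbrs q.1 (q.2 m).2) q.2 m := by
  let _ : MeasurableSpace (Finset Vertex) := ⊤
  have : DiscreteMeasurableSpace (Finset Vertex) := ⟨fun _ => trivial⟩
  have h1 : Measurable (fun q : Finset Vertex × JumpData => stepLaw q.1 q.2 m) :=
    measurable_from_prod_countable_right fun F => measurable_stepLaw F m
  have h3 : Measurable (fun q : Offspring × Vertex => nbrs q.1 q.2) := by
    refine measurable_from_prod_countable_left fun y => ?_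
    unfold nbrs
    exact (measurable_of_countable (fun k : ℕ =>
      (Finset.range k).image (fun i => i :: y) ∪ parents y)).comp (measurable_pi_apply y)
  have h4 : Measurable (fun q : Offspring × JumpData => (q.2 m).2) := by fun_prop
  exact h1.comp ((h3.comp (measurable_fst.prodMk h4)).prodMk measurable_snd)

lemma measurable_returnProb (j m : ℕ) :
    Measurable fun q : Offspring × JumpData => returnProb q.1 j m q.2 := by
  induction j generalizing m with
  | zero =>
    exact (measurable_one.indicator (measurableSet_noReturn m).compl).comp measurable_snd
  | succ j ih =>
    let κ : Kernel (Offspring × JumpData) (ℝ≥0 × Vertex) := ⟨_, measurable_stepLaw_nbrs m⟩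
    have : IsMarkovKernel κ := ⟨fun _ => isProbabilityMeasure_stepLaw _ _ _⟩
    refine Measurable.lintegral_kernel_prod_right (κ := κ)
      (f := fun q z => returnProb q.1 j (m + 1) (snoc m q.2 z)) ?_
    exact (ih (m + 1)).comp (Measurable.prodMk (by fun_prop)
      ((measurable_snoc m).comp (Measurable.prodMk (by fun_prop) (by fun_prop))))

/-- The martingale property of the conditional probabilities `returnProb`. -/
lemma lintegral_partialTraj_returnProb (N : Offspring) (m j : ℕ) :
    ∫⁻ h, returnProb N j m (extend m h)
      ∂Kernel.partialTraj (X := fun _ : ℕ => ℝ≥0 × Vertex) (stepKernel N) 0 m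
        (fun _ => (0, root)) = returnProb N (m + j) 0 (fun _ => (0, root)) := by
  have hmeas : ∀ j m, Measurable fun h : (i : Finset.Iic m) → ℝ≥0 × Vertex =>
      returnProb N j m (extend m h) := fun j m =>
    (measurable_returnProb j m).comp (measurable_const.prodMk (measurable_extend m))
  induction m generalizing j with
  | zero =>
    rw [Kernel.partialTraj_self, Kernel.id_apply, lintegral_dirac' _ (hmeas j 0), zero_add]
    rfl
  | succ m ih =>
    rw [Kernel.partialTraj_succ_eq_comp (Nat.zero_le m), Kernel.lintegral_comp _ _ _ (hmeas j _),
      show m + 1 + j = m + (j + 1) by omega, ← ih]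
    refine lintegral_congr fun h => ?_
    have hI : Measurable (IicProdIoc (X := fun _ : ℕ => ℝ≥0 × Vertex) m (m + 1)) :=
      measurable_IicProdIoc
    have hg : Measurable fun q => returnProb N j (m + 1) (extend (m + 1)
        (IicProdIoc (X := fun _ : ℕ => ℝ≥0 × Vertex) m (m + 1) q)) := (hmeas j _).comp hI
    have hg' : Measurable fun b => returnProb N j (m + 1) (extend (m + 1)
        (IicProdIoc (X := fun _ : ℕ => ℝ≥0 × Vertex) m (m + 1) (h, b))) :=
      hg.comp measurable_prodMk_left
    rw [Kernel.partialTraj_succ_self, Kernel.lintegral_map _ hI _ (hmeas j _),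
      Kernel.lintegral_id_prod hg, Kernel.lintegral_map _ (by fun_prop) _ hg']
    refine lintegral_congr fun z => ?_
    congr 1
    funext k
    rcases Nat.lt_or_ge m k with hk | hk
    · have : min k (m + 1) = m + 1 := by omega
      simp [extend, snoc, IicProdIoc, MeasurableEquiv.piSingleton, hk.not_ge, this]
    · have : min k (m + 1) = k := by omega
      simp [extend, snoc, IicProdIoc, hk, this]

lemma vrjpLaw_compl_noReturn (N : Offspring) (n : ℕ) :
    vrjpLaw N (noReturn (n + 1))ᶜ = returnProb N (n + 1) 0 (fun _ => (0, root)) := by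
  have h := lintegral_partialTraj_returnProb N (n + 1) 0
  have hm : Measurable fun h => extend (n + 1) h := measurable_extend (n + 1)
  have hs := (measurableSet_noReturn (n + 1)).compl
  rw [add_zero] at h
  rw [← h]
  change _ = ∫⁻ h, (noReturn (n + 1))ᶜ.indicator 1 (extend (n + 1) h) ∂_
  rw [← lintegral_map (measurable_one.indicator hs) hm, lintegral_indicator_one hs,
    Measure.map_apply hm hs, ← Kernel.traj_map_frestrictLe_apply,
    Measure.map_apply (by fun_prop) (hm hs)]
  change vrjpLaw N _ = vrjpLaw N _
  congr 1
  ext ω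
  have hk : ∀ k ≤ n + 1, extend (n + 1) (Preorder.frestrictLe (π := fun _ : ℕ => ℝ≥0 × Vertex)
      (n + 1) ω) k = ω k := by
    intro k hk
    simp [extend, hk]
  simp only [Set.mem_preimage, Set.mem_compl_iff, noReturn, Set.mem_ofPred_eq]
  rw [hk 0 (by omega), hk 1 (by omega)]
  refine not_congr (and_congr_right fun _ => and_congr_right fun _ =>
    forall₂_congr fun k hk' => ?_)
  rw [hk _ (by omega)]

/-- If the jump times have a finite limit, then `process` is `none` from there on, hence still away
from the root. -/
lemma neverReturns_of_noReturn {ω : JumpData} (h : ∀ n, ω ∈ noReturn n) :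
    NeverReturns (process ω) root := by
  refine ⟨(ω 1).1, (h 0).2.1, fun t ht => ?_, fun t ht h0 => ?_⟩
  · have h1 : ∃ n, t < jumpTime ω (n + 1) := ⟨0, by simpa [jumpTime] using ht⟩
    have h2 : Nat.find h1 = 0 := by
      rw [Nat.find_eq_zero]; simpa [jumpTime] using ht
    rw [process, dif_pos h1, h2, (h 0).1]
  · unfold process at h0
    split_ifs at h0 with h1
    have h2 : Nat.find h1 ≠ 0 := by
      intro h2
      rw [Nat.find_eq_zero] at h2
      simp only [jumpTime, zero_add, Finset.range_one, Finset.sum_singleton] at h2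
      exact absurd ht (not_le.2 h2)
    obtain ⟨k, hk⟩ := Nat.exists_eq_succ_of_ne_zero h2
    rw [hk] at h0
    exact (h (k + 1)).2.2 k (Nat.lt_succ_self k) (Option.some.inj h0)

/-! ### The escape bound and the potential -/

/-- A lower bound for the probability of never returning from a vertex to its parent, if `r` is the
local time of the parent and `x` is `ε exp (-a / 2)` times the number of unvisited children, where
`1 + a` is the local time of the vertex. -/
def escape (r x : ℝ) : ℝ := x / (r + 3 / 2) * (1 - x / 4)

lemma escape_nonneg {r x : ℝ} (hr : 1 ≤ r) (h0 : 0 ≤ x) (h1 : x ≤ 1) : 0 ≤ escape r x :=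
  mul_nonneg (div_nonneg h0 (by linarith)) (by linarith)

lemma escape_le_one {r x : ℝ} (hr : 1 ≤ r) (h0 : 0 ≤ x) (h1 : x ≤ 1) : escape r x ≤ 1 := by
  have h2 : x / (r + 3 / 2) ≤ 1 := by rw [div_le_one (by linarith)]; linarith
  exact mul_le_one₀ h2 (by linarith) (by linarith)

/-- The inequality behind the supermartingale property, before integration over the sojourn time
`τ`. Here `u` is the number of fresh children, `l` is the total rate of the other children, and
`z * e` is `ε exp (-a / 2)` at the end of the sojourn, with `e = exp (-τ / 2)`. The left side weighs
by its rate a bound for the potential after a jump to the parent, to a fresh child, or to another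
child, relative to the potential of the parent. The right side, divided by the total rate, has mean
`1 - escape r (u * z)` under the exponential law of `τ`. -/
lemma escape_drift_le {r u l z e : ℝ} (hr : 1 ≤ r) (hu : 0 ≤ u) (hz : 0 ≤ z) (he : 0 ≤ e) :
    r + u * ((1 - escape r ((u - 1) * (z * e))) * (1 - z * e)) + l * (1 - escape r (u * (z * e))) ≤
      (r + u + l) - u * z * (r + u + l + 1 / 2) / (r + 3 / 2) * e +
        (u * z) ^ 2 * (r + u + l + 1) / (4 * (r + 3 / 2)) * (e * e) := by
  have hr' : 0 < r + 3 / 2 := by linarith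
  rw [← sub_nonneg]
  have : (r + u + l) - u * z * (r + u + l + 1 / 2) / (r + 3 / 2) * e +
        (u * z) ^ 2 * (r + u + l + 1) / (4 * (r + 3 / 2)) * (e * e) -
      (r + u * ((1 - escape r ((u - 1) * (z * e))) * (1 - z * e)) +
        l * (1 - escape r (u * (z * e)))) =
      u * (z * e) ^ 2 / (4 * (r + 3 / 2)) * (3 + u * (r - 1) + (u - 1) ^ 2 * (z * e)) := by
    unfold escape
    field_simp
    ring
  rw [this]
  have : 0 ≤ r - 1 := by linarith
  positivity

/-- The indices of the children of `v` outside `A`, among the first `K` children of `v`. With `A`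
the set of visited vertices, these are the children that may contribute to an escape. -/
def fresh (K : ℕ) (N : Offspring) (A : Finset Vertex) (v : Vertex) : Finset ℕ :=
  (Finset.range (min (N v) K)).filter fun i => i :: v ∉ A

lemma card_fresh_le (K : ℕ) (N : Offspring) (A : Finset Vertex) (v : Vertex) :
    (fresh K N A v).card ≤ K :=
  (Finset.card_filter_le _ _).trans (by simp)

/-- An upper bound for the probability to return to the root from a given vertex, for the local
times `L` and the visited vertices `A`: the product of `1 - escape` over that vertex and its
ancestors, the root excluded. It depends on `N` only through these vertices, so that it bounds the
return probability averaged over the rest of the tree. -/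
def potential (ε : ℝ) (K : ℕ) (N : Offspring) (L : Vertex → ℝ≥0) (A : Finset Vertex) :
    Vertex → ℝ
  | [] => 1
  | i :: v => (1 - escape (L v) ((fresh K N A (i :: v)).card *
      (ε * Real.exp (-(((L (i :: v) : ℝ) - 1) / 2))))) * potential ε K N L A v

/-- The potential of `v` only depends on vertices not further from the root than `v`, and on which
children of these are visited. -/
lemma potential_congr {ε : ℝ} {K : ℕ} {N N' : Offspring} {L L' : Vertex → ℝ≥0}
    {A A' : Finset Vertex} {v : Vertex}
    (h : ∀ w : Vertex, w.length ≤ v.length → N w = N' w ∧ L w = L' w ∧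
      ∀ i : ℕ, (i :: w ∈ A ↔ i :: w ∈ A')) :
    potential ε K N L A v = potential ε K N' L' A' v := by
  induction v with
  | nil => rfl
  | cons i v ih =>
    obtain ⟨h1, h2, h3⟩ := h (i :: v) le_rfl
    have h4 := (h v (by simp)).2.1
    have hf : fresh K N A (i :: v) = fresh K N' A' (i :: v) := by
      unfold fresh
      rw [h1]
      exact Finset.filter_congr fun i _ => not_congr (h3 i)
    rw [potential, potential, ih fun w hw => h w (hw.trans (by simp)), hf, h2, h4]

lemma escape_arg_mem {ε : ℝ} {K c : ℕ} (hε : 0 ≤ ε) (hK : ε * K ≤ 1) (hc : c ≤ K)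
    {t : ℝ} (ht0 : 0 ≤ t) (ht : t ≤ 1) : 0 ≤ c * (ε * t) ∧ c * (ε * t) ≤ 1 := by
  refine ⟨by positivity, le_trans ?_ hK⟩
  have : (c : ℝ) ≤ K := by exact_mod_cast hc
  calc (c : ℝ) * (ε * t) ≤ K * (ε * 1) := by gcongr
    _ = ε * K := by ring

lemma potential_mem_Icc {ε : ℝ} {K : ℕ} (hε : 0 ≤ ε) (hK : ε * K ≤ 1) (N : Offspring)
    {L : Vertex → ℝ≥0} (hL : ∀ v, 1 ≤ L v) (A : Finset Vertex) (v : Vertex) :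
    0 ≤ potential ε K N L A v ∧ potential ε K N L A v ≤ 1 := by
  induction v with
  | nil => exact ⟨zero_le_one, le_rfl⟩
  | cons i v ih =>
    have h1 : (1 : ℝ) ≤ L v := by exact_mod_cast hL v
    have h2 : (1 : ℝ) ≤ L (i :: v) := by exact_mod_cast hL (i :: v)
    obtain ⟨h3, h4⟩ := escape_arg_mem hε hK (card_fresh_le K N A (i :: v))
      (Real.exp_pos (-(((L (i :: v) : ℝ) - 1) / 2))).le (Real.exp_le_one_iff.2 (by linarith))
    have h5 := escape_nonneg h1 h3 h4
    have h6 := escape_le_one h1 h3 h4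
    rw [potential]
    exact ⟨mul_nonneg (by linarith) ih.1, mul_le_one₀ (by linarith) ih.1 ih.2⟩

/-- At a vertex just entered from a parent of local time `1 + s`, the average of `escape` over the
number of children is at least `ε exp (-s / 2)`. This is where the mean of the truncated offspring
enters, through `exp (s / 2) ≥ 1 + s / 2 ≥ (5 / 2 + s) / (5 / 2)`. -/
lemma lintegral_offspring_escape_le {p : PMF ℕ} {ε : ℝ} {K : ℕ} (hε : 0 ≤ ε) (hK : ε * K ≤ 1)
    (hp : 5 / 2 ≤ ∫ k : ℕ, ((min k K : ℕ) : ℝ) * (1 - (min k K : ℕ) * ε / 4) ∂p.toMeasure)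
    {s c : ℝ} (hs : 0 ≤ s) (hc : 0 ≤ c) :
    ∫⁻ k : ℕ, ENNReal.ofReal ((1 - escape (1 + s) ((min k K : ℕ) * ε)) * c) ∂p.toMeasure ≤
      ENNReal.ofReal ((1 - ε * Real.exp (-(s / 2))) * c) := by
  have hmem : ∀ k : ℕ, 0 ≤ ((min k K : ℕ) : ℝ) * ε ∧ ((min k K : ℕ) : ℝ) * ε ≤ 1 := fun k => by
    simpa using escape_arg_mem (t := 1) hε hK (min_le_right k K) zero_le_one le_rfl
  have h1 : ∀ k : ℕ, 0 ≤ escape (1 + s) ((min k K : ℕ) * ε) := fun k =>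
    escape_nonneg (by linarith) (hmem k).1 (hmem k).2
  have h2 : ∀ k : ℕ, escape (1 + s) ((min k K : ℕ) * ε) ≤ 1 := fun k =>
    escape_le_one (by linarith) (hmem k).1 (hmem k).2
  have hint : Integrable (fun k : ℕ => escape (1 + s) ((min k K : ℕ) * ε)) p.toMeasure := by
    refine Integrable.of_bound (C := 1)
      (measurable_of_countable _).aestronglyMeasurable (ae_of_all _ fun k => ?_)
    rw [Real.norm_of_nonneg (h1 k)]
    exact h2 k
  have hint' : Integrable (fun k : ℕ => (1 - escape (1 + s) ((min k K : ℕ) * ε)) * c)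
      p.toMeasure := ((integrable_const 1).sub hint).mul_const c
  rw [← ofReal_integral_eq_lintegral_ofReal hint' (ae_of_all _ fun k =>
    mul_nonneg (by linarith [h2 k]) hc), integral_mul_const, integral_sub (integrable_const 1) hint]
  refine ENNReal.ofReal_le_ofReal (mul_le_mul_of_nonneg_right ?_ hc)
  have h3 : ∀ k : ℕ, escape (1 + s) ((min k K : ℕ) * ε) = ε / (1 + s + 3 / 2) *
      (((min k K : ℕ) : ℝ) * (1 - (min k K : ℕ) * ε / 4)) := fun k => by
    unfold escape; ring
  have h4 : Real.exp (-(s / 2)) ≤ 1 / (1 + s + 3 / 2) * (5 / 2) := by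
    rw [Real.exp_neg, div_mul_eq_mul_div, one_mul, inv_le_comm₀ (Real.exp_pos _) (by positivity),
      inv_div, div_le_iff₀ (by norm_num)]
    linarith [Real.add_one_le_exp (s / 2)]
  simp_rw [h3]
  rw [integral_const_mul]
  have h5 : ε * Real.exp (-(s / 2)) ≤ ε / (1 + s + 3 / 2) * (5 / 2) := by
    calc _ ≤ ε * (1 / (1 + s + 3 / 2) * (5 / 2)) := by gcongr
      _ = _ := by ring
  have h6 : ε / (1 + s + 3 / 2) * (5 / 2) ≤ ε / (1 + s + 3 / 2) *
      ∫ k : ℕ, ((min k K : ℕ) : ℝ) * (1 - (min k K : ℕ) * ε / 4) ∂p.toMeasure := by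
    gcongr
  rw [integral_const, probReal_univ, one_smul]
  linarith

/-! ### One step of the process -/

lemma lintegral_stepLaw {F : Finset Vertex} (hF : F ≠ ∅) (ω : JumpData) (m : ℕ)
    {f : ℝ≥0 × Vertex → ℝ≥0∞} (hf : Measurable f) :
    ∫⁻ z, f z ∂stepLaw F ω m = ∫⁻ τ, ∑ y ∈ F,
      ((localTime ω m y / totalRate F ω m : ℝ≥0) : ℝ≥0∞) * f (τ, y)
        ∂holdLaw (totalRate F ω m) := by
  have hf' : ∀ y, Measurable fun τ => f (τ, y) := fun y => hf.comp (by fun_prop)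
  rw [stepLaw, if_neg hF, lintegral_finsetSum_measure,
    lintegral_finsetSum _ fun y _ => (hf' y).const_mul _]
  refine Finset.sum_congr rfl fun y _ => ?_
  rw [lintegral_smul_measure, lintegral_map hf (by fun_prop), lintegral_const_mul _ (hf' y),
    smul_eq_mul]

lemma sum_nbrs_cons {M : Type*} [AddCommMonoid M] (N : Offspring) (i : ℕ) (v : Vertex)
    (f : Vertex → M) :
    ∑ y ∈ nbrs N (i :: v), f y = f v + ∑ k ∈ Finset.range (N (i :: v)), f (k :: i :: v) := by
  have h : v ∉ (Finset.range (N (i :: v))).image fun k => k :: i :: v := by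
    intro h
    obtain ⟨k, -, hk⟩ := Finset.mem_image.1 h
    have := congrArg List.length hk
    simp only [List.length_cons] at this
    omega
  rw [nbrs, parents, Finset.union_comm, Finset.singleton_union, Finset.sum_insert h,
    Finset.sum_image fun a _ b _ hab => (List.cons.inj hab).1]

/-- The process has not returned to the root, and the visited vertices form a subtree. -/
def IsExplored (m : ℕ) (ω : JumpData) : Prop :=
  ω ∈ noReturn m ∧ ∀ i v, i :: v ∈ visited m ω → v ∈ visited m ω

lemma isExplored_snoc {m : ℕ} (hm : 1 ≤ m) {ω : JumpData} (h : IsExplored m ω)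
    {z : ℝ≥0 × Vertex} (hz : z.2 ≠ root) (hv : ∀ i v, z.2 = i :: v → v ∈ visited m ω) :
    IsExplored (m + 1) (snoc m ω z) := by
  refine ⟨⟨?_, ?_, fun k hk => ?_⟩, fun i v hi => ?_⟩
  · rw [snoc_of_le (Nat.zero_le m)]; exact h.1.1
  · rw [snoc_of_le hm]; exact h.1.2.1
  · rcases Nat.lt_or_ge k m with hkm | hkm
    · rw [snoc_of_le hkm]; exact h.1.2.2 k hkm
    · obtain rfl : k = m := by omega
      rwa [snoc_succ]
  · rw [visited_snoc, Finset.mem_insert] at hi ⊢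
    rcases hi with hi | hi
    · exact Or.inr (hv i v hi.symm)
    · exact Or.inr (h.2 i v hi)

/-- `escape_drift_le`, integrated over the sojourn time: `G τ` stands for the mean of the return
probability after a sojourn of length `τ`, and `P` for the potential of the parent. -/
lemma lintegral_holdLaw_drift_le {r u l z P : ℝ} {ρ : ℝ≥0} (hr : 1 ≤ r) (hu : 0 ≤ u)
    (hz : 0 ≤ z) (hl : 0 ≤ l) (hP : 0 ≤ P) (hρ : (ρ : ℝ) = r + u + l) {G : ℝ≥0 → ℝ≥0∞}
    (hpos : ∀ τ : ℝ≥0, 0 ≤ r + u * ((1 - escape r ((u - 1) *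
      (z * Real.exp (-(1 / 2 * (τ : ℝ)))))) * (1 - z * Real.exp (-(1 / 2 * (τ : ℝ))))) +
      l * (1 - escape r (u * (z * Real.exp (-(1 / 2 * (τ : ℝ)))))))
    (hG : ∀ τ : ℝ≥0, G τ ≤ ENNReal.ofReal ((r + u * ((1 - escape r ((u - 1) *
      (z * Real.exp (-(1 / 2 * (τ : ℝ)))))) * (1 - z * Real.exp (-(1 / 2 * (τ : ℝ))))) +
      l * (1 - escape r (u * (z * Real.exp (-(1 / 2 * (τ : ℝ))))))) / ρ * P)) :
    ∫⁻ τ, G τ ∂holdLaw ρ ≤ ENNReal.ofReal ((1 - escape r (u * z)) * P) := by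
  have hρ0 : (0 : ℝ) < ρ := by rw [hρ]; linarith
  set A : ℝ := u * z * (ρ + 1 / 2) / (r + 3 / 2) / ρ with hA
  set B : ℝ := (u * z) ^ 2 * (ρ + 1) / (4 * (r + 3 / 2)) / ρ with hB
  have hd : ∀ τ : ℝ≥0, (r + u * ((1 - escape r ((u - 1) *
      (z * Real.exp (-(1 / 2 * (τ : ℝ)))))) * (1 - z * Real.exp (-(1 / 2 * (τ : ℝ))))) +
      l * (1 - escape r (u * (z * Real.exp (-(1 / 2 * (τ : ℝ))))))) / ρ ≤
      1 - A * Real.exp (-(1 / 2 * (τ : ℝ))) + B * Real.exp (-(1 * (τ : ℝ))) := by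
    intro τ
    have h := escape_drift_le (l := l) hr hu hz (Real.exp_pos (-(1 / 2 * (τ : ℝ)))).le
    rw [← hρ, ← Real.exp_add] at h
    rw [div_le_iff₀ hρ0]
    refine h.trans (le_of_eq ?_)
    rw [hA, hB]
    field_simp
    ring_nf
  have hnn : ∀ τ : ℝ≥0,
      0 ≤ 1 - A * Real.exp (-(1 / 2 * (τ : ℝ))) + B * Real.exp (-(1 * (τ : ℝ))) :=
    fun τ => (div_nonneg (hpos τ) hρ0.le).trans (hd τ)
  calc ∫⁻ τ, G τ ∂holdLaw ρ ≤ ∫⁻ τ : ℝ≥0, ENNReal.ofReal P * ENNReal.ofReal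
        (1 - A * Real.exp (-(1 / 2 * (τ : ℝ))) + B * Real.exp (-(1 * (τ : ℝ)))) ∂holdLaw ρ := by
        refine lintegral_mono fun τ => (hG τ).trans ?_
        rw [← ENNReal.ofReal_mul hP, mul_comm P]
        exact ENNReal.ofReal_le_ofReal (mul_le_mul_of_nonneg_right (hd τ) hP)
    _ = ENNReal.ofReal ((1 - escape r (u * z)) * P) := by
        rw [lintegral_const_mul _ (by fun_prop), lintegral_holdLaw (by exact_mod_cast hρ0) A B hnn,
          ← ENNReal.ofReal_mul hP, mul_comm P]
        congr 2
        have : r + 3 / 2 ≠ 0 := by linarith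
        rw [hA, hB, escape]
        field_simp
        ring

lemma nbrs_congr {N N' : Offspring} {v : Vertex} (h : N v = N' v) : nbrs N v = nbrs N' v := by
  rw [nbrs, nbrs, h]

/-- One step of the process, averaged over the unexplored part of the tree. -/
lemma lintegral_returnProb_succ (p : PMF ℕ) (N : Offspring) (j m : ℕ) (ω : JumpData)
    (hne : nbrs N (ω m).2 ≠ ∅) :
    ∫⁻ N', returnProb ((visited m ω).piecewise N N') (j + 1) m ω ∂gwLaw p =
      ∫⁻ τ, ∑ y ∈ nbrs N (ω m).2,
        ((localTime ω m y / totalRate (nbrs N (ω m).2) ω m : ℝ≥0) : ℝ≥0∞) *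
        ∫⁻ N', returnProb ((visited m ω).piecewise N N') j (m + 1) (snoc m ω (τ, y)) ∂gwLaw p
          ∂holdLaw (totalRate (nbrs N (ω m).2) ω m) := by
  have hx : (ω m).2 ∈ visited m ω := mem_visited.2 ⟨m, le_rfl, rfl⟩
  have := isProbabilityMeasure_holdLaw (totalRate_pos hne ω m)
  have hmeas : Measurable fun q : Offspring × (ℝ≥0 × Vertex) =>
      returnProb ((visited m ω).piecewise N q.1) j (m + 1) (snoc m ω q.2) :=
    (measurable_returnProb j (m + 1)).comp
      (((measurable_piecewise_offspring _ N).comp measurable_fst).prodMk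
        ((measurable_snoc m).comp (measurable_const.prodMk measurable_snd)))
  have hF : ∀ N' : Offspring, nbrs ((visited m ω).piecewise N N') (ω m).2 = nbrs N (ω m).2 :=
    fun N' => nbrs_congr (Finset.piecewise_eq_of_mem _ _ _ hx)
  have h1 : ∀ N' : Offspring, returnProb ((visited m ω).piecewise N N') (j + 1) m ω =
      ∫⁻ τ, ∑ y ∈ nbrs N (ω m).2,
        ((localTime ω m y / totalRate (nbrs N (ω m).2) ω m : ℝ≥0) : ℝ≥0∞) *
        returnProb ((visited m ω).piecewise N N') j (m + 1) (snoc m ω (τ, y))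
          ∂holdLaw (totalRate (nbrs N (ω m).2) ω m) := by
    intro N'
    have h2 : Measurable fun z => returnProb ((visited m ω).piecewise N N') j (m + 1)
        (snoc m ω z) := hmeas.comp measurable_prodMk_left
    rw [returnProb, hF, lintegral_stepLaw hne ω m h2]
  have hmeas' : ∀ y, Measurable fun q : Offspring × ℝ≥0 =>
      returnProb ((visited m ω).piecewise N q.1) j (m + 1) (snoc m ω (q.2, y)) := fun y =>
    hmeas.comp (by fun_prop : Measurable fun q : Offspring × ℝ≥0 => (q.1, (q.2, y)))
  simp_rw [h1]
  rw [lintegral_lintegral_swap]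
  · refine lintegral_congr fun τ => ?_
    have h2 : ∀ y, Measurable fun N' => returnProb ((visited m ω).piecewise N N') j (m + 1)
        (snoc m ω (τ, y)) := fun y => (hmeas' y).comp measurable_prodMk_right
    rw [lintegral_finsetSum _ fun y _ => (h2 y).const_mul _]
    exact Finset.sum_congr rfl fun y _ => lintegral_const_mul _ (h2 y)
  · exact (Finset.measurable_sum _ fun y _ => (hmeas' y).const_mul _).aemeasurable

lemma fresh_update_self (K : ℕ) (N : Offspring) {A : Finset Vertex} {y : Vertex}
    (hA : ∀ i v, i :: v ∈ A → v ∈ A) (hy : y ∉ A) (k : ℕ) :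
    (fresh K (Function.update N y k) (insert y A) y).card = min k K := by
  rw [fresh, Finset.filter_true_of_mem, Function.update_self, Finset.card_range]
  intro i _ hi
  rcases Finset.mem_insert.1 hi with hi | hi
  · exact absurd (congrArg List.length hi) (by simp)
  · exact hy (hA _ _ hi)

/-- A jump to a fresh child removes it from the fresh children. -/
lemma card_fresh_insert {K : ℕ} {N : Offspring} {A : Finset Vertex} {x : Vertex} {i : ℕ}
    (hi : i ∈ fresh K N A x) :
    ((fresh K N (insert (i :: x) A) x).card : ℝ) = (fresh K N A x).card - 1 := by
  have : fresh K N (insert (i :: x) A) x = (fresh K N A x).erase i := by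
    ext k
    simp only [fresh, Finset.mem_filter, Finset.mem_erase, Finset.mem_insert, List.cons.injEq,
      and_true, not_or]
    tauto
  rw [this, Finset.card_erase_of_mem hi, Nat.cast_sub (Finset.card_pos.2 ⟨i, hi⟩), Nat.cast_one]

lemma fresh_insert_of_notMem {K : ℕ} {N : Offspring} {A : Finset Vertex} {x : Vertex} {i : ℕ}
    (hi : i ∉ fresh K N A x) :
    fresh K N (insert (i :: x) A) x = fresh K N A x := by
  ext k
  simp only [fresh, Finset.mem_filter, Finset.mem_insert, List.cons.injEq,
      and_true, not_or] at hi ⊢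
  constructor
  · tauto
  · rintro ⟨h1, h2⟩
    refine ⟨h1, ?_, h2⟩
    rintro rfl
    exact hi ⟨h1, h2⟩

/-- The supermartingale bound: averaged over the unexplored part of the tree, the conditional
probability to return to the root within the next `j` jumps is at most the potential. -/
theorem lintegral_returnProb_le {p : PMF ℕ} {ε : ℝ} {K : ℕ} (hε : 0 ≤ ε) (hK : ε * K ≤ 1)
    (hp : 5 / 2 ≤ ∫ k : ℕ, ((min k K : ℕ) : ℝ) * (1 - (min k K : ℕ) * ε / 4) ∂p.toMeasure)
    (N : Offspring) (j : ℕ) {m : ℕ} (hm : 1 ≤ m) {ω : JumpData} (hω : IsExplored m ω) :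
    ∫⁻ N', returnProb ((visited m ω).piecewise N N') j m ω ∂gwLaw p ≤
      ENNReal.ofReal (potential ε K N (localTime ω m) (visited m ω) (ω m).2) := by
  induction j generalizing m ω N with
  | zero =>
    simp only [returnProb, Set.indicator_of_notMem (Set.notMem_compl_iff.2 hω.1), lintegral_zero]
    exact zero_le
  | succ j ih =>
    have hx : (ω m).2 ∈ visited m ω := mem_visited.2 ⟨m, le_rfl, rfl⟩
    have hroot : (ω m).2 ≠ root := by
      obtain ⟨k, rfl⟩ := Nat.exists_eq_add_of_le' hm
      exact hω.1.2.2 k (Nat.lt_succ_self k)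
    obtain ⟨i₀, v, hxv⟩ := List.exists_cons_of_ne_nil hroot
    have hv : v ∈ visited m ω := hω.2 i₀ v (hxv ▸ hx)
    have hvF : v ∈ nbrs N (ω m).2 := by rw [hxv]; simp [nbrs, parents]
    have hne : nbrs N (ω m).2 ≠ ∅ := Finset.ne_empty_of_mem hvF
    rw [lintegral_returnProb_succ p N j m ω hne]
    set A := visited m ω with hA
    set x : Vertex := i₀ :: v with hxdef
    set P := potential ε K N (localTime ω m) A v with hPdef
    have hL : ∀ w, (1 : ℝ) ≤ localTime ω m w := fun w => by
      exact_mod_cast one_le_localTime ω m w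
    have hP := potential_mem_Icc hε hK N (one_le_localTime ω m) A v
    -- the potential at the parent of `x` does not change in the next jump
    have hanc : ∀ (N' : Offspring) (τ : ℝ≥0) (y : Vertex), (∀ w : Vertex, w.length ≤ v.length →
        N w = N' w) → (y ∈ A ∨ ∃ i, y = i :: x) →
        potential ε K N' (localTime (snoc m ω (τ, y)) (m + 1)) (insert y A) v = P := by
      intro N' τ y hN hy
      refine (potential_congr fun w hw => ⟨hN w hw, ?_, fun i => ?_⟩).symm
      · rw [localTime_snoc, if_neg, add_zero]
        rw [hxv]
        rintro rfl
        simp [x] at hw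
      · rw [Finset.mem_insert]
        refine ⟨Or.inr, ?_⟩
        rintro (h | h)
        · rcases hy with hy | ⟨i', rfl⟩
          · exact h ▸ hy
          · obtain rfl := (List.cons.inj h).2
            simp [x] at hw
        · exact h
    set r : ℝ := ((localTime ω m v : ℝ≥0) : ℝ) with hr
    set z : ℝ := ε * Real.exp (-(((localTime ω m x : ℝ) - 1) / 2)) with hz
    set u : ℝ := (((fresh K N A x).card : ℕ) : ℝ) with hu
    set l : ℝ := ∑ i ∈ Finset.range (N x) \ fresh K N A x, (localTime ω m (i :: x) : ℝ) with hl
    have hz0 : 0 ≤ z := by positivity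
    have hl0 : 0 ≤ l := Finset.sum_nonneg fun i _ => NNReal.coe_nonneg _
    have hfreshL : ∀ i ∈ fresh K N A x, localTime ω m (i :: x) = 1 := fun i hi =>
      localTime_eq_one (Finset.mem_filter.1 hi).2
    have hsub : fresh K N A x ⊆ Finset.range (N x) := (Finset.filter_subset _ _).trans
      (Finset.range_subset_range.2 (min_le_left _ _))
    have hρ : (totalRate (nbrs N (ω m).2) ω m : ℝ) = r + u + l := by
      have h1 : ∑ i ∈ fresh K N A x, (localTime ω m (i :: x) : ℝ) = u := by
        rw [Finset.sum_congr rfl fun i hi => by rw [hfreshL i hi], Finset.sum_const,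
          NNReal.coe_one, nsmul_one]
      rw [totalRate, hxv, hxdef, sum_nbrs_cons, ← hxdef, NNReal.coe_add, NNReal.coe_sum,
        ← Finset.sum_sdiff hsub, h1, add_assoc, add_comm u]
    -- the arguments of `escape` after the next jump stay in the unit interval
    have hexp : ∀ τ : ℝ≥0, Real.exp (-(((localTime ω m x : ℝ) - 1) / 2)) *
        Real.exp (-(1 / 2 * (τ : ℝ))) ≤ 1 := fun τ => by
      rw [← Real.exp_add, Real.exp_le_one_iff]
      have := hL x
      have := τ.coe_nonneg
      linarith
    have harg : ∀ (c : ℕ) (τ : ℝ≥0), c ≤ K → 0 ≤ c * (z * Real.exp (-(1 / 2 * (τ : ℝ)))) ∧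
        c * (z * Real.exp (-(1 / 2 * (τ : ℝ)))) ≤ 1 := fun c τ hc => by
      have := escape_arg_mem hε hK hc (by positivity) (hexp τ)
      rwa [← mul_assoc ε] at this
    have hesc : ∀ (c : ℕ) (τ : ℝ≥0), c ≤ K →
        0 ≤ 1 - escape r (c * (z * Real.exp (-(1 / 2 * (τ : ℝ))))) := fun c τ hc =>
      sub_nonneg.2 (escape_le_one (hL v) (harg c τ hc).1 (harg c τ hc).2)
    have hpred : ∀ i ∈ fresh K N A x, ((fresh K N A x).card - 1 : ℕ) = u - 1 := fun i hi => by
      rw [hu, Nat.cast_sub (Finset.card_pos.2 ⟨i, hi⟩), Nat.cast_one]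
    have hcardK := card_fresh_le K N A x
    have hb₁ : ∀ (τ : ℝ≥0), ∀ i ∈ fresh K N A x, 0 ≤
        (1 - escape r ((u - 1) * (z * Real.exp (-(1 / 2 * (τ : ℝ)))))) *
          (1 - z * Real.exp (-(1 / 2 * (τ : ℝ)))) := fun τ i hi => by
      rw [← hpred i hi]
      refine mul_nonneg (hesc _ τ (by omega)) ?_
      have h1 := (harg 1 τ ((Finset.card_pos.2 ⟨i, hi⟩).trans_le hcardK)).2
      rw [Nat.cast_one, one_mul] at h1
      linarith
    have hb₂ : ∀ τ : ℝ≥0, 0 ≤ 1 - escape r (u * (z * Real.exp (-(1 / 2 * (τ : ℝ))))) :=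
      fun τ => hesc _ τ hcardK
    -- the potential at a child of `x`, just after a jump to that child
    have hchild : ∀ (N' : Offspring) (τ : ℝ≥0) (i : ℕ),
        (∀ w : Vertex, w.length ≤ x.length → N w = N' w) →
        potential ε K N' (localTime (snoc m ω (τ, i :: x)) (m + 1)) (insert (i :: x) A) (i :: x) =
          (1 - escape (localTime ω m x + τ) ((fresh K N' (insert (i :: x) A) (i :: x)).card *
            (ε * Real.exp (-(((localTime ω m (i :: x) : ℝ) - 1) / 2))))) *
          ((1 - escape r ((fresh K N (insert (i :: x) A) x).card *
            (z * Real.exp (-(1 / 2 * (τ : ℝ)))))) * P) := by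
      intro N' τ i hN
      have h1 : localTime (snoc m ω (τ, i :: x)) (m + 1) x = localTime ω m x + τ := by
        rw [localTime_snoc, if_pos hxv]
      have h2 : localTime (snoc m ω (τ, i :: x)) (m + 1) (i :: x) = localTime ω m (i :: x) := by
        rw [localTime_snoc, if_neg (by rw [hxv]; exact (List.cons_ne_self i x).symm), add_zero]
      have h3 : localTime (snoc m ω (τ, i :: x)) (m + 1) v = localTime ω m v := by
        rw [localTime_snoc, if_neg (by rw [hxv]; exact List.cons_ne_self i₀ v), add_zero]
      have h4 : fresh K N' (insert (i :: x) A) x = fresh K N (insert (i :: x) A) x := by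
        unfold fresh; rw [hN x le_rfl]
      have h5 : z * Real.exp (-(1 / 2 * (τ : ℝ))) =
          ε * Real.exp (-((((localTime ω m x + τ : ℝ≥0) : ℝ) - 1) / 2)) := by
        rw [hz, mul_assoc, ← Real.exp_add, NNReal.coe_add]
        ring_nf
      rw [potential, h1, h2, h5, ← h4]
      conv_lhs => rw [hxdef, potential, ← hxdef, h1, h3,
        hanc N' τ (i :: x) (fun w hw => hN w (hw.trans (by simp [x]))) (Or.inr ⟨i, rfl⟩)]
      rw [NNReal.coe_add]
    have hIH : ∀ (N' : Offspring) (τ : ℝ≥0) (y : Vertex), y ≠ root →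
        (∀ i w, y = i :: w → w ∈ A) →
        ∫⁻ N'', returnProb ((insert y A).piecewise N' N'') j (m + 1) (snoc m ω (τ, y)) ∂gwLaw p ≤
          ENNReal.ofReal (potential ε K N' (localTime (snoc m ω (τ, y)) (m + 1))
            (insert y A) y) := by
      intro N' τ y hy hyA
      have h := ih N' (by omega) (isExplored_snoc hm hω (z := (τ, y)) hy hyA)
      rwa [visited_snoc, snoc_succ] at h
    -- bounds for a jump to the parent, to a child that is not fresh, and to a fresh child
    have hGv : ∀ τ : ℝ≥0,
        ∫⁻ N', returnProb (A.piecewise N N') j (m + 1) (snoc m ω (τ, v)) ∂gwLaw p ≤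
          ENNReal.ofReal P := by
      intro τ
      by_cases hvr : v = root
      -- at the root the potential is `1`, which bounds any probability
      · have : P = 1 := by rw [hPdef, hvr, potential]
        rw [this, ENNReal.ofReal_one]
        calc _ ≤ ∫⁻ _, 1 ∂gwLaw p := lintegral_mono fun N' => returnProb_le_one _ _ _ _
          _ = 1 := by simp
      · have h := hIH N τ v hvr fun i w hiw => hω.2 i w (hiw ▸ hv)
        rwa [hanc N τ v (fun _ _ => rfl) (Or.inl hv), Finset.insert_eq_of_mem hv] at h
    -- a new vertex reveals its number of children
    have hnew : ∀ (τ : ℝ≥0) (y : Vertex), y ∉ A →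
        ∫⁻ N', returnProb (A.piecewise N N') j (m + 1) (snoc m ω (τ, y)) ∂gwLaw p =
        ∫⁻ k, ∫⁻ N', returnProb ((insert y A).piecewise (Function.update N y k) N') j (m + 1)
          (snoc m ω (τ, y)) ∂gwLaw p ∂p.toMeasure := fun τ y hy =>
      lintegral_gwLaw_piecewise p hy N ((measurable_returnProb j (m + 1)).comp
        (measurable_id.prodMk measurable_const))
    have hupd : ∀ (i k : ℕ) (w : Vertex), w.length ≤ x.length →
        N w = Function.update N (i :: x) k w := by
      intro i k w hw
      rw [Function.update_of_ne]
      rintro rfl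
      simp at hw
    have hchild_ne : ∀ i : ℕ, i :: x ≠ root := fun i => List.cons_ne_nil i x
    have hchild_mem : ∀ i j w, i :: x = j :: w → w ∈ A := fun i j w h => by
      rw [← (List.cons.inj h).2, ← hxv]; exact hx
    have hold : ∀ (N' : Offspring) (τ : ℝ≥0) (i : ℕ), i ∉ fresh K N A x →
        (∀ w : Vertex, w.length ≤ x.length → N w = N' w) →
        ∫⁻ N'', returnProb ((insert (i :: x) A).piecewise N' N'') j (m + 1)
          (snoc m ω (τ, i :: x)) ∂gwLaw p ≤
          ENNReal.ofReal ((1 - escape r (u * (z * Real.exp (-(1 / 2 * (τ : ℝ)))))) * P) := by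
      intro N' τ i hi hN
      refine (hIH N' τ (i :: x) (hchild_ne i) (hchild_mem i)).trans (ENNReal.ofReal_le_ofReal ?_)
      rw [hchild N' τ i hN, fresh_insert_of_notMem hi]
      refine mul_le_of_le_one_left (mul_nonneg (hb₂ τ) hP.1) ?_
      have h1 := escape_arg_mem hε hK (card_fresh_le K N' (insert (i :: x) A) (i :: x))
        (Real.exp_pos (-(((localTime ω m (i :: x) : ℝ) - 1) / 2))).le
        (Real.exp_le_one_iff.2 (by linarith [hL (i :: x)]))
      have h2 : 1 ≤ (localTime ω m x : ℝ) + τ := by linarith [hL x, τ.coe_nonneg]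
      linarith [escape_nonneg h2 h1.1 h1.2]
    -- a child that is not fresh may still be unvisited, if its index is at least `K`
    have hG₂ : ∀ (τ : ℝ≥0) (i : ℕ), i ∉ fresh K N A x →
        ∫⁻ N', returnProb (A.piecewise N N') j (m + 1) (snoc m ω (τ, i :: x)) ∂gwLaw p ≤
          ENNReal.ofReal ((1 - escape r (u * (z * Real.exp (-(1 / 2 * (τ : ℝ)))))) * P) := by
      intro τ i hi
      by_cases hiA : i :: x ∈ A
      · have h := hold N τ i hi fun _ _ => rfl
        rwa [Finset.insert_eq_of_mem hiA] at h
      · rw [hnew τ _ hiA]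
        calc _ ≤ ∫⁻ _, _ ∂p.toMeasure :=
              lintegral_mono fun k => hold _ τ i hi (hupd i k)
          _ = _ := by simp
    have hG₁ : ∀ (τ : ℝ≥0), ∀ i ∈ fresh K N A x,
        ∫⁻ N', returnProb (A.piecewise N N') j (m + 1) (snoc m ω (τ, i :: x)) ∂gwLaw p ≤
          ENNReal.ofReal ((1 - escape r ((u - 1) * (z * Real.exp (-(1 / 2 * (τ : ℝ)))))) *
            (1 - z * Real.exp (-(1 / 2 * (τ : ℝ)))) * P) := by
      intro τ i hi
      have hiA : i :: x ∉ A := (Finset.mem_filter.1 hi).2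
      have hs : 0 ≤ (localTime ω m x : ℝ) - 1 + τ := by linarith [hL x, τ.coe_nonneg]
      have hc : 0 ≤ (1 - escape r ((u - 1) * (z * Real.exp (-(1 / 2 * (τ : ℝ)))))) * P := by
        rw [← hpred i hi]
        exact mul_nonneg (hesc _ τ (by omega)) hP.1
      rw [hnew τ _ hiA]
      refine (lintegral_mono fun k => hIH _ τ (i :: x) (hchild_ne i) (hchild_mem i)).trans ?_
      refine (lintegral_mono fun k => ENNReal.ofReal_le_ofReal (le_of_eq ?_)).trans
        ((lintegral_offspring_escape_le hε hK hp hs hc).trans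
          (ENNReal.ofReal_le_ofReal (le_of_eq ?_)))
      · change potential ε K (Function.update N (i :: x) k) _ _ _ = _
        rw [hchild _ τ i (hupd i k), card_fresh_insert hi, fresh_update_self K N hω.2 hiA,
          hfreshL i hi, NNReal.coe_one, sub_self, zero_div, neg_zero, Real.exp_zero, mul_one]
        rw [show 1 + ((localTime ω m x : ℝ) - 1 + τ) = localTime ω m x + τ by ring]
      · have : ε * Real.exp (-(((localTime ω m x : ℝ) - 1 + τ) / 2)) =
            z * Real.exp (-(1 / 2 * (τ : ℝ))) := by
          rw [hz, mul_assoc, ← Real.exp_add]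
          ring_nf
        rw [this]
        ring
    have hpot : potential ε K N (localTime ω m) A (ω m).2 = (1 - escape r (u * z)) * P := by
      rw [hxv, hxdef, potential]
    rw [hpot]
    refine lintegral_holdLaw_drift_le (hL v) (Nat.cast_nonneg _) hz0 hl0 hP.1 hρ
      (fun τ => ?_) fun τ => ?_
    · have h1 : 0 ≤ u * ((1 - escape r ((u - 1) * (z * Real.exp (-(1 / 2 * (τ : ℝ)))))) *
          (1 - z * Real.exp (-(1 / 2 * (τ : ℝ))))) := by
        rcases (fresh K N A x).eq_empty_or_nonempty with h | ⟨i, hi⟩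
        · rw [hu, h]; simp
        · exact mul_nonneg (Nat.cast_nonneg _) (hb₁ τ i hi)
      have h2 := mul_nonneg hl0 (hb₂ τ)
      have := hL v
      linarith
    · set ρ := totalRate (nbrs N (ω m).2) ω m with hρdef
      set b₁ : ℝ := (1 - escape r ((u - 1) * (z * Real.exp (-(1 / 2 * (τ : ℝ)))))) *
        (1 - z * Real.exp (-(1 / 2 * (τ : ℝ))))
      set b₂ : ℝ := 1 - escape r (u * (z * Real.exp (-(1 / 2 * (τ : ℝ)))))
      have hterm : ∀ (y : Vertex) (b : ℝ) (g : ℝ≥0∞), g ≤ ENNReal.ofReal b →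
          ((localTime ω m y / ρ : ℝ≥0) : ℝ≥0∞) * g ≤
            ENNReal.ofReal ((localTime ω m y : ℝ) / ρ * b) := by
        intro y b g hg
        rw [ENNReal.ofReal_mul (by positivity), ← NNReal.coe_div, ENNReal.ofReal_coe_nnreal]
        gcongr
      have hs₁ : ∀ i ∈ fresh K N A x, 0 ≤ (localTime ω m (i :: x) : ℝ) / ρ * (b₁ * P) :=
        fun i hi => mul_nonneg (by positivity) (mul_nonneg (hb₁ τ i hi) hP.1)
      have hs₂ : ∀ i ∈ Finset.range (N x) \ fresh K N A x,
          0 ≤ (localTime ω m (i :: x) : ℝ) / ρ * (b₂ * P) :=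
        fun i _ => mul_nonneg (by positivity) (mul_nonneg (hb₂ τ) hP.1)
      have hsum₁ : ∑ i ∈ fresh K N A x, (localTime ω m (i :: x) : ℝ) / ρ * (b₁ * P) =
          u * b₁ / ρ * P := by
        rw [Finset.sum_congr rfl fun i hi => by rw [hfreshL i hi], Finset.sum_const,
          NNReal.coe_one, nsmul_eq_mul]
        ring
      have hsum₂ : ∑ i ∈ Finset.range (N x) \ fresh K N A x,
          (localTime ω m (i :: x) : ℝ) / ρ * (b₂ * P) = l * b₂ / ρ * P := by
        rw [← Finset.sum_mul, ← Finset.sum_div]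
        ring
      have hsplit : (r + u * b₁ + l * b₂) / ρ * P = r / ρ * P + (l * b₂ / ρ * P +
          u * b₁ / ρ * P) := by ring
      rw [hsplit, ← hsum₁, ← hsum₂, ENNReal.ofReal_add (mul_nonneg (by positivity) hP.1)
        (add_nonneg (Finset.sum_nonneg hs₂) (Finset.sum_nonneg hs₁)),
        ENNReal.ofReal_add (Finset.sum_nonneg hs₂) (Finset.sum_nonneg hs₁),
        ENNReal.ofReal_sum_of_nonneg hs₁, ENNReal.ofReal_sum_of_nonneg hs₂, hxv, hxdef,
        sum_nbrs_cons, ← hxdef, ← Finset.sum_sdiff hsub]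
      exact add_le_add (hterm v P _ (hGv τ)) (add_le_add
        (Finset.sum_le_sum fun i hi => hterm _ _ _ (hG₂ τ i (Finset.mem_sdiff.1 hi).2))
        (Finset.sum_le_sum fun i hi => hterm _ _ _ (hG₁ τ i hi)))

/-! ### The first jump -/

lemma sum_localTime_div_totalRate {F : Finset Vertex} (hF : F ≠ ∅) (ω : JumpData) (m : ℕ) :
    ∑ y ∈ F, ((localTime ω m y / totalRate F ω m : ℝ≥0) : ℝ≥0∞) = 1 := by
  rw [← ENNReal.ofNNReal_finsetSum, ← Finset.sum_div]
  change (((totalRate F ω m) / (totalRate F ω m) : ℝ≥0) : ℝ≥0∞) = 1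
  rw [div_self (totalRate_pos hF ω m).ne', ENNReal.coe_one]

lemma one_le_totalRate {F : Finset Vertex} (hF : F ≠ ∅) (ω : JumpData) (m : ℕ) :
    1 ≤ totalRate F ω m := by
  obtain ⟨y, hy⟩ := Finset.nonempty_iff_ne_empty.2 hF
  exact (one_le_localTime ω m y).trans
    (Finset.single_le_sum (f := fun y => localTime ω m y) (fun _ _ => zero_le) hy)

/-- The bound just after the first jump, to the child `i` of the root. -/
lemma lintegral_returnProb_child_le {p : PMF ℕ} {ε : ℝ} {K : ℕ} (hε : 0 ≤ ε) (hK : ε * K ≤ 1)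
    (hp : 5 / 2 ≤ ∫ k : ℕ, ((min k K : ℕ) : ℝ) * (1 - (min k K : ℕ) * ε / 4) ∂p.toMeasure)
    (N : Offspring) (j i : ℕ) {τ : ℝ≥0} (hτ : 0 < τ) {ω : JumpData} (hω : (ω 0).2 = root) :
    ∫⁻ N', returnProb ((visited 0 ω).piecewise N N') j 1 (snoc 0 ω (τ, [i])) ∂gwLaw p ≤
      ENNReal.ofReal (1 - ε * Real.exp (-(1 / 2 * (τ : ℝ)))) := by
  have hvis : visited 0 ω = {root} := by simp [visited, hω]
  have hi : [i] ∉ visited 0 ω := by simp [hvis]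
  have htree : ∀ (k : ℕ) (v : Vertex), k :: v ∈ visited 0 ω → v ∈ visited 0 ω := by
    intro k v h
    rw [hvis, Finset.mem_singleton] at h
    exact absurd h (List.cons_ne_nil k v)
  have hex : IsExplored 1 (snoc 0 ω (τ, [i])) := by
    refine ⟨⟨?_, ?_, ?_⟩, ?_⟩
    · rwa [snoc_of_le le_rfl]
    · rwa [snoc_succ 0]
    · intro k hk
      obtain rfl : k = 0 := by omega
      rw [snoc_succ]
      exact List.cons_ne_nil i []
    · intro k v h
      rw [visited_snoc, Finset.mem_insert] at h ⊢
      rcases h with h | h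
      · rw [(List.cons.inj h).2]
        exact Or.inr (hvis ▸ Finset.mem_singleton_self _)
      · exact Or.inr (htree k v h)
  have hf : Measurable fun N' => returnProb N' j 1 (snoc 0 ω (τ, [i])) :=
    (measurable_returnProb j 1).comp (measurable_id.prodMk measurable_const)
  rw [lintegral_gwLaw_piecewise p hi N hf]
  have hpot : ∀ k : ℕ, ∫⁻ N', returnProb ((insert [i] (visited 0 ω)).piecewise
      (Function.update N [i] k) N') j 1 (snoc 0 ω (τ, [i])) ∂gwLaw p ≤
      ENNReal.ofReal ((1 - escape (1 + τ) ((min k K : ℕ) * ε)) * 1) := by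
    intro k
    have h := lintegral_returnProb_le hε hK hp (Function.update N [i] k) j le_rfl hex
    rw [visited_snoc, snoc_succ 0] at h
    refine h.trans (ENNReal.ofReal_le_ofReal (le_of_eq ?_))
    have h0 : ∀ y, localTime ω 0 y = 1 := fun y => by simp [localTime]
    have h1 : localTime (snoc 0 ω (τ, [i])) 1 [] = 1 + τ := by
      rw [localTime_snoc 0, if_pos hω, h0]
    have h2 : localTime (snoc 0 ω (τ, [i])) 1 [i] = 1 := by
      rw [localTime_snoc 0, if_neg (by rw [hω]; exact (List.cons_ne_nil i []).symm), h0, add_zero]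
    rw [potential, potential, fresh_update_self K N htree hi, h1, h2]
    simp
  refine (lintegral_mono hpot).trans
    ((lintegral_offspring_escape_le hε hK hp τ.coe_nonneg zero_le_one).trans
      (le_of_eq ?_))
  rw [mul_one]
  ring_nf

/-- Only the first sojourn, spent at the root, has to be integrated out. The total rate `ρ` is at
least `1`, whence `ρ / (ρ + 1 / 2) ≥ 2 / 3`. -/
lemma lintegral_returnProb_root_le {p : PMF ℕ} {ε : ℝ} {K : ℕ} (hε : 0 ≤ ε) (hε1 : ε ≤ 1)
    (hK : ε * K ≤ 1)
    (hp : 5 / 2 ≤ ∫ k : ℕ, ((min k K : ℕ) : ℝ) * (1 - (min k K : ℕ) * ε / 4) ∂p.toMeasure)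
    (N : Offspring) (hN : N root ≠ 0) (j : ℕ) {ω : JumpData} (hω : (ω 0).2 = root) :
    ∫⁻ N', returnProb ((visited 0 ω).piecewise N N') (j + 1) 0 ω ∂gwLaw p ≤
      ENNReal.ofReal (1 - 2 / 3 * ε) := by
  have hF : nbrs N (ω 0).2 = (Finset.range (N root)).image fun i => [i] := by
    rw [hω]; simp [nbrs, parents]
  have hne : nbrs N (ω 0).2 ≠ ∅ := by
    rw [hF]; simpa using hN
  have hρ := totalRate_pos hne ω 0
  have hρ1 := one_le_totalRate hne ω 0
  rw [lintegral_returnProb_succ p N j 0 ω hne]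
  set ρ := totalRate (nbrs N (ω 0).2) ω 0 with hρdef
  have hae : ∀ᵐ τ : ℝ≥0 ∂holdLaw ρ, 0 < τ := by
    have : ∀ᵐ τ : ℝ≥0 ∂holdLaw ρ, τ ∉ ({0} : Set ℝ≥0) :=
      measure_eq_zero_iff_ae_notMem.1 (holdLaw_singleton_zero ρ)
    filter_upwards [this] with τ hτ
    exact pos_iff_ne_zero.2 hτ
  calc _ ≤ ∫⁻ τ : ℝ≥0, ENNReal.ofReal (1 - ε * Real.exp (-(1 / 2 * (τ : ℝ))) +
        0 * Real.exp (-(1 * (τ : ℝ)))) ∂holdLaw ρ := by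
        refine lintegral_mono_ae ?_
        filter_upwards [hae] with τ hτ
        rw [zero_mul, add_zero]
        calc _ ≤ ∑ y ∈ nbrs N (ω 0).2, ((localTime ω 0 y / ρ : ℝ≥0) : ℝ≥0∞) *
              ENNReal.ofReal (1 - ε * Real.exp (-(1 / 2 * (τ : ℝ)))) := by
              refine Finset.sum_le_sum fun y hy => mul_le_mul_right ?_ _
              rw [hF] at hy
              obtain ⟨i, -, rfl⟩ := Finset.mem_image.1 hy
              exact lintegral_returnProb_child_le hε hK hp N j i hτ hω
          _ = _ := by rw [← Finset.sum_mul, sum_localTime_div_totalRate hne, one_mul]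
    _ = ENNReal.ofReal (1 - ε * (ρ / (ρ + 1 / 2)) + 0 * (ρ / (ρ + 1))) := by
        refine lintegral_holdLaw hρ ε 0 fun τ => ?_
        have h1 : Real.exp (-(1 / 2 * (τ : ℝ))) ≤ 1 := Real.exp_le_one_iff.2 (by
          have := τ.coe_nonneg
          linarith)
        have := mul_le_one₀ hε1 (Real.exp_pos _).le h1
        linarith
    _ ≤ ENNReal.ofReal (1 - 2 / 3 * ε) := by
        refine ENNReal.ofReal_le_ofReal ?_
        have h1 : (1 : ℝ) ≤ ρ := by exact_mod_cast hρ1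
        have h2 : (2 / 3 : ℝ) ≤ ρ / (ρ + 1 / 2) := by
          rw [le_div_iff₀ (by linarith)]; linarith
        have := mul_le_mul_of_nonneg_left h2 hε
        linarith

/-- The probability to return to the root is bounded away from `1`, uniformly in the number of
jumps. If the root has no children, the return probability is bounded by `1`. -/
lemma exists_lintegral_returnProb_le {p : PMF ℕ} {ε : ℝ} {K : ℕ} (hε : 0 < ε) (hε1 : ε ≤ 1)
    (hK : ε * K ≤ 1)
    (hp : 5 / 2 ≤ ∫ k : ℕ, ((min k K : ℕ) : ℝ) * (1 - (min k K : ℕ) * ε / 4) ∂p.toMeasure) :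
    ∃ c < 1, ∀ n, ∫⁻ N, returnProb N (n + 1) 0 (fun _ => (0, root)) ∂gwLaw p ≤ c := by
  set q : ℝ≥0∞ := ENNReal.ofReal (1 - 2 / 3 * ε) with hq
  have hq1 : q < 1 := by
    rw [hq, ENNReal.ofReal_lt_one]; linarith
  have hpos : p.toMeasure {0}ᶜ ≠ 0 := by
    intro h
    have hae : ∀ᵐ k ∂p.toMeasure, k = 0 := by
      filter_upwards [measure_eq_zero_iff_ae_notMem.1 h] with k hk
      simpa using hk
    have : ∫ k : ℕ, ((min k K : ℕ) : ℝ) * (1 - (min k K : ℕ) * ε / 4) ∂p.toMeasure = 0 := by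
      refine integral_eq_zero_of_ae ?_
      filter_upwards [hae] with k hk
      simp [hk]
    linarith
  refine ⟨p.toMeasure {0} + q * p.toMeasure {0}ᶜ, ?_, fun n => ?_⟩
  · calc p.toMeasure {0} + q * p.toMeasure {0}ᶜ < p.toMeasure {0} + 1 * p.toMeasure {0}ᶜ := by
          have h : q * p.toMeasure {0}ᶜ < 1 * p.toMeasure {0}ᶜ :=
            (ENNReal.mul_lt_mul_iff_left hpos (measure_ne_top p.toMeasure {0}ᶜ)).2 hq1
          exact (ENNReal.add_lt_add_iff_left (measure_ne_top p.toMeasure {0})).2 h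
      _ = 1 := by rw [one_mul, measure_add_measure_compl (measurableSet_singleton _), measure_univ]
  · let ω₀ : JumpData := fun _ => (0, root)
    have hω₀ : Measurable fun N : Offspring => (N, ω₀) := measurable_prodMk_right
    have hf : Measurable fun N => returnProb N (n + 1) 0 ω₀ :=
      (measurable_returnProb (n + 1) 0).comp hω₀
    have h := lintegral_gwLaw_piecewise p (Finset.notMem_empty root) (fun _ => 0) hf
    simp only [Finset.piecewise_empty] at h
    rw [h]
    have hvis : visited 0 ω₀ = insert root ∅ := by simp [visited, ω₀]
    calc _ ≤ ∫⁻ k, (({0} : Set ℕ).indicator (fun _ => 1) k +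
          ({0}ᶜ : Set ℕ).indicator (fun _ => q) k) ∂p.toMeasure := by
          refine lintegral_mono fun k => ?_
          rcases eq_or_ne k 0 with rfl | hk
          · simp only [Set.mem_singleton_iff, Set.indicator_of_mem, Set.mem_compl_iff,
              not_true_eq_false, not_false_eq_true, Set.indicator_of_notMem, add_zero]
            calc _ ≤ ∫⁻ _, 1 ∂gwLaw p := lintegral_mono fun N' => returnProb_le_one _ _ _ _
              _ = 1 := by simp
          · simp only [Set.mem_singleton_iff, hk, not_false_eq_true, Set.indicator_of_notMem,
              Set.mem_compl_iff, Set.indicator_of_mem, zero_add]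
            rw [← hvis]
            exact lintegral_returnProb_root_le hε.le hε1 hK hp _ (by simpa using hk) n rfl
      _ = _ := by
          rw [lintegral_add_left (measurable_of_countable _),
            lintegral_indicator_const (measurableSet_singleton _),
            lintegral_indicator_const (measurableSet_singleton _).compl, one_mul]

/-! ### Truncation of the offspring distribution -/

/-- By monotone convergence the mean of `min k K` exceeds `11 / 4` for some `K`. With
`ε = 1 / (3 K)` the correction costs a factor of at most `11 / 12`, and
`11 / 4 * (11 / 12) > 5 / 2`. -/
lemma exists_truncation {p : PMF ℕ} (hm : ENNReal.ofReal (11 / 4) < offspringMean p) :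
    ∃ (ε : ℝ) (K : ℕ), 0 < ε ∧ ε ≤ 1 ∧ ε * K ≤ 1 ∧
      5 / 2 ≤ ∫ k : ℕ, ((min k K : ℕ) : ℝ) * (1 - (min k K : ℕ) * ε / 4) ∂p.toMeasure := by
  have h1 : offspringMean p = ∫⁻ k : ℕ, ⨆ K : ℕ, ((min k K : ℕ) : ℝ≥0∞) ∂p.toMeasure := by
    rw [lintegral_countable']
    refine tsum_congr fun k => ?_
    rw [p.toMeasure_apply_singleton k (measurableSet_singleton k), mul_comm]
    congr 1
    refine le_antisymm ?_ (iSup_le fun K => by exact_mod_cast min_le_left k K)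
    exact le_iSup_of_le k (by simp)
  rw [h1, lintegral_iSup (fun K => measurable_of_countable _) (fun K K' h k => by
    exact_mod_cast min_le_min_left k h)] at hm
  obtain ⟨K, hK⟩ := lt_iSup_iff.1 hm
  have hb : ∀ k : ℕ, ((min k K : ℕ) : ℝ) ≤ K := fun k => by exact_mod_cast min_le_right k K
  have hint : Integrable (fun k : ℕ => ((min k K : ℕ) : ℝ)) p.toMeasure := by
    refine Integrable.of_bound (C := K) (measurable_of_countable _).aestronglyMeasurable
      (ae_of_all _ fun k => ?_)
    rw [Real.norm_of_nonneg (Nat.cast_nonneg _)]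
    exact hb k
  have hmean : 11 / 4 < ∫ k : ℕ, ((min k K : ℕ) : ℝ) ∂p.toMeasure := by
    have h2 : ∫⁻ k : ℕ, ((min k K : ℕ) : ℝ≥0∞) ∂p.toMeasure =
        ENNReal.ofReal (∫ k : ℕ, ((min k K : ℕ) : ℝ) ∂p.toMeasure) := by
      rw [ofReal_integral_eq_lintegral_ofReal hint (ae_of_all _ fun k => Nat.cast_nonneg _)]
      simp_rw [ENNReal.ofReal_natCast]
    rw [h2] at hK
    exact ENNReal.ofReal_lt_ofReal_iff_of_nonneg (by norm_num) |>.1 hK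
  have hK0 : K ≠ 0 := by
    rintro rfl
    simp at hmean
    linarith
  have hK1 : (1 : ℝ) ≤ K := by exact_mod_cast Nat.one_le_iff_ne_zero.2 hK0
  refine ⟨1 / (3 * K), K, by positivity, ?_, ?_, ?_⟩
  · rw [div_le_one (by positivity)]; linarith
  · rw [div_mul_eq_mul_div, div_le_one (by positivity)]; linarith
  · have h3 : ∀ k : ℕ, ((min k K : ℕ) : ℝ) * (11 / 12) ≤
        ((min k K : ℕ) : ℝ) * (1 - (min k K : ℕ) * (1 / (3 * K)) / 4) := fun k => by
      refine mul_le_mul_of_nonneg_left ?_ (Nat.cast_nonneg _)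
      have : ((min k K : ℕ) : ℝ) * (1 / (3 * K)) ≤ 1 / 3 := by
        rw [mul_one_div, div_le_div_iff₀ (by positivity) (by norm_num)]
        linarith [hb k]
      linarith
    have h4 : Integrable (fun k : ℕ => ((min k K : ℕ) : ℝ) *
        (1 - (min k K : ℕ) * (1 / (3 * K)) / 4)) p.toMeasure := by
      refine Integrable.of_bound (C := K) (measurable_of_countable _).aestronglyMeasurable
        (ae_of_all _ fun k => ?_)
      rw [Real.norm_of_nonneg ((mul_nonneg (Nat.cast_nonneg _) (by norm_num)).trans (h3 k))]
      refine (mul_le_of_le_one_right (Nat.cast_nonneg _) ?_).trans (hb k)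
      have : 0 ≤ ((min k K : ℕ) : ℝ) * (1 / (3 * K)) := by positivity
      linarith
    have h5 := integral_mono (hint.mul_const (11 / 12)) h4 h3
    rw [integral_mul_const] at h5
    linarith

end VRJP

end

theorem theorem3 (p : PMF ℕ)
    (hm : ENNReal.ofReal (1 / 0.36) < VRJP.offspringMean p)
    (hfin : VRJP.offspringMean p < ⊤) :
    0 < VRJP.vrjpGW p {q | VRJP.NeverReturns (VRJP.process q.2) VRJP.root} := by
  obtain ⟨ε, K, hε, hε1, hK, hp⟩ := VRJP.exists_truncation
    ((ENNReal.ofReal_le_ofReal (by norm_num)).trans_lt hm)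
  obtain ⟨c, hc, hret⟩ := VRJP.exists_lintegral_returnProb_le hε hε1 hK hp
  have hmeas : ∀ n, MeasurableSet {q : VRJP.Offspring × VRJP.JumpData | q.2 ∈ VRJP.noReturn n} :=
    fun n => measurable_snd (VRJP.measurableSet_noReturn n)
  have hanti : ∀ ω : VRJP.JumpData, ∀ n m, n ≤ m → ω ∈ VRJP.noReturn m → ω ∈ VRJP.noReturn n :=
    fun ω n m hnm h => ⟨h.1, h.2.1, fun k hk => h.2.2 k (hk.trans_le hnm)⟩
  set E : Set (VRJP.Offspring × VRJP.JumpData) := {q | ∀ n, q.2 ∈ VRJP.noReturn (n + 1)} with hE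
  have hEm : MeasurableSet E := by
    have : E = ⋂ n, {q | q.2 ∈ VRJP.noReturn (n + 1)} := by ext; simp [hE]
    rw [this]
    exact MeasurableSet.iInter fun n => hmeas (n + 1)
  have hEc : VRJP.vrjpGW p Eᶜ ≤ c := by
    have h1 : Eᶜ = ⋃ n, {q | q.2 ∈ VRJP.noReturn (n + 1)}ᶜ := by ext; simp [hE]
    have h2 : Monotone fun n => {q : VRJP.Offspring × VRJP.JumpData |
        q.2 ∈ VRJP.noReturn (n + 1)}ᶜ := fun n m hnm =>
      Set.compl_subset_compl.2 fun q hq => hanti q.2 _ _ (by omega) hq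
    rw [h1, h2.measure_iUnion]
    refine iSup_le fun n => ?_
    rw [VRJP.vrjpGW, Measure.compProd_apply (hmeas (n + 1)).compl]
    refine le_trans (le_of_eq (lintegral_congr fun N => ?_)) (hret n)
    exact VRJP.vrjpLaw_compl_noReturn N n
  have hEpos : 0 < VRJP.vrjpGW p E := by
    rw [prob_compl_eq_one_sub hEm] at hEc
    by_contra h
    rw [nonpos_iff_eq_zero.1 (not_lt.1 h), tsub_zero] at hEc
    exact absurd hc (not_lt.2 hEc)
  refine hEpos.trans_le (measure_mono fun q hq => VRJP.neverReturns_of_noReturn fun n => ?_)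
  exact hanti q.2 _ _ (Nat.le_succ n) (hq n)
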